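/- For a finite simple graph $G=(V,E)$ let $\chi(G;q)$ be its chromatic polynomial, i.e. the unique monic polynomial of degree $|V|$ whose value at every $q\in\mathbb{N}$ is the number of proper $q$-colourings of $G$, and let $P(G;z):=(-z)^{|V|}\,\chi(G;-1/z)$, which is a polynomial in $z$. For a function $f$ that is analytic at $0$, $f=\sum_{k\ge 0}a_kz^k$ near $0$, and $m\ge 1$, let $f^{[m]}(z):=\sum_{k=0}^m a_kz^k$ be its $m$-th Taylor polynomial. Graphs are given in adjacency list format: the number of neighbours of a vertex and each single entry of its list of neighbours (in any order) can be read in constant time. Running times count the elementary steps of a random access machine with unit cost, which adds, subtracts and tests natural numbers (addresses, vertices, counters) and carries out exact arithmetic operations on rational numbers (coefficients) in one step each. **Theorem.** There exist an algorithm and an absolute constant $C>0$ such that, for all integers $n,\Delta,m\ge 1$, on input of $m$ and of an $n$-vertex graph $G$ of maximum degree at most $\Delta$, given in adjacency list format, the algorithm computes the Taylor polynomial $\log(P(G;z))^{[m]}$ (where $\log$ is the principal branch; $\log P(G;z)$ is analytic at $z=0$) in time at most $$C\cdot n\,\Delta\,(3e\Delta)^m\,m^3 .$$ -/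

import Mathlib

open Polynomial

noncomputable section

namespace ChromaticTaylor

/-! ### The chromatic polynomial and its companion `P(G; z)` -/

section Chromatic

/-- The number of proper colourings of `G` that use all of `j` colours. -/
def surjColorings {V : Type*} (G : SimpleGraph V) (j : ℕ) : ℕ :=
  Nat.card {c : G.Coloring (Fin j) // Function.Surjective c}

/-- Proper colourings whose set of used colours is `S` are surjective colourings by `S`. -/
theorem card_range_eq {V : Type*} (G : SimpleGraph V) {q : ℕ} (S : Finset (Fin q)) :
    Nat.card {c : G.Coloring (Fin q) // Set.range c = (S : Set (Fin q))} =
      surjColorings G S.card := by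
  classical
  refine Nat.card_congr ?_
  let e : S ≃ Fin S.card := S.equivFin
  refine
    { toFun := fun c => ⟨SimpleGraph.Coloring.mk
        (fun v => e ⟨c.1 v, by
          have : c.1 v ∈ Set.range c.1 := ⟨v, rfl⟩
          rw [c.2] at this; exact this⟩) ?_, ?_⟩
      invFun := fun d => ⟨SimpleGraph.Coloring.mk (fun v => (e.symm (d.1 v) : Fin q)) ?_, ?_⟩
      left_inv := ?_
      right_inv := ?_ }
  · intro v w h hvw
    have := e.injective hvw
    exact c.1.valid h (by simpa using this)
  · intro y
    have hy : ((e.symm y : S) : Fin q) ∈ Set.range c.1 := by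
      rw [c.2]; exact (e.symm y).2
    obtain ⟨v, hv⟩ := hy
    refine ⟨v, ?_⟩
    change e ⟨c.1 v, _⟩ = y
    rw [← e.apply_symm_apply y]
    congr 1
    exact Subtype.ext hv
  · intro v w h hvw
    exact d.1.valid h (e.symm.injective (Subtype.ext hvw))
  · ext x
    constructor
    · rintro ⟨v, rfl⟩
      exact (e.symm (d.1 v)).2
    · intro hx
      obtain ⟨v, hv⟩ := d.2 (e ⟨x, hx⟩)
      refine ⟨v, ?_⟩
      change ((e.symm (d.1 v) : S) : Fin q) = x
      rw [hv, e.symm_apply_apply]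
  · rintro ⟨c, hc⟩
    apply Subtype.ext
    apply DFunLike.ext
    intro v
    change ((e.symm (e ⟨c v, _⟩) : S) : Fin q) = c v
    rw [e.symm_apply_apply]
  · rintro ⟨d, hd⟩
    apply Subtype.ext
    apply DFunLike.ext
    intro v
    change e ⟨(e.symm (d v) : Fin q), _⟩ = d v
    exact e.apply_symm_apply (d v)

variable {V : Type*} [Fintype V]

/-- `χ` is a chromatic polynomial of `G`: it is monic of degree `|V|`, and for every natural
number `q` its value at `q` is the number of proper `q`-colourings of `G`. -/
def IsChromaticPolynomial (G : SimpleGraph V) (χ : ℂ[X]) : Prop :=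
  χ.Monic ∧ χ.natDegree = Fintype.card V ∧
    ∀ q : ℕ, χ.eval (q : ℂ) = (Nat.card (G.Coloring (Fin q)) : ℂ)

theorem card_coloring_eq_sum (G : SimpleGraph V) (q : ℕ) :
    Nat.card (G.Coloring (Fin q)) =
      ∑ j ∈ Finset.range (q + 1), q.choose j * surjColorings G j := by
  classical
  have h1 : Nat.card (G.Coloring (Fin q)) = Nat.card (Σ S : Finset (Fin q),
      {c : G.Coloring (Fin q) // Set.range c = (S : Set (Fin q))}) := by
    refine Nat.card_congr (Equiv.symm ?_)
    refine (Equiv.sigmaCongrRight fun S => Equiv.subtypeEquivRight fun c => ?_).trans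
      (Equiv.sigmaFiberEquiv (fun c : G.Coloring (Fin q) => (Set.range c).toFinset))
    constructor
    · intro h; ext x; simp [h]
    · intro h; rw [← h]; simp
  have : Finite (G.Coloring (Fin q)) :=
    Finite.of_injective (fun c : G.Coloring (Fin q) => (c : V → Fin q)) DFunLike.coe_injective
  rw [h1, Nat.card_sigma]
  simp only [card_range_eq]
  have := Finset.sum_powerset_apply_card (x := (Finset.univ : Finset (Fin q)))
    (fun j => surjColorings G j)
  simpa using this

theorem surjColorings_eq_zero (G : SimpleGraph V) {j : ℕ} (hj : Fintype.card V < j) :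
    surjColorings G j = 0 := by
  have : IsEmpty {c : G.Coloring (Fin j) // Function.Surjective c} :=
    ⟨fun c => by
      have := Fintype.card_le_of_surjective _ c.2
      simp at this; omega⟩
  exact Nat.card_of_isEmpty

theorem surjColorings_card (G : SimpleGraph V) :
    surjColorings G (Fintype.card V) = (Fintype.card V).factorial := by
  classical
  have e : {c : G.Coloring (Fin (Fintype.card V)) // Function.Surjective c} ≃
      (V ≃ Fin (Fintype.card V)) :=
    { toFun := fun c => Equiv.ofBijective c.1
        ((Fintype.bijective_iff_surjective_and_card _).2 ⟨c.2, by simp⟩)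
      invFun := fun f => ⟨SimpleGraph.Coloring.mk f
        (fun h hvw => h.ne (f.injective hvw)), f.surjective⟩
      left_inv := fun c => Subtype.ext (DFunLike.ext _ _ fun v => rfl)
      right_inv := fun f => Equiv.ext fun v => rfl }
  rw [surjColorings, Nat.card_congr e, Nat.card_eq_fintype_card,
    Fintype.card_equiv (Fintype.equivFin V)]

/-- Every finite graph has exactly one chromatic polynomial. -/
theorem existsUnique_isChromaticPolynomial (G : SimpleGraph V) :
    ∃! χ : ℂ[X], IsChromaticPolynomial G χ := by
  classical
  set n := Fintype.card V with hn
  let term : ℕ → ℂ[X] := fun j =>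
    C ((surjColorings G j : ℂ) / (j.factorial : ℂ)) * descPochhammer ℂ j
  have hfac : ∀ j : ℕ, ((j.factorial : ℕ) : ℂ) ≠ 0 := fun j =>
    Nat.cast_ne_zero.2 (Nat.factorial_ne_zero j)
  have hterm : ∀ j q : ℕ, (term j).eval (q : ℂ) = (q.choose j * surjColorings G j : ℕ) := by
    intro j q
    simp only [term, eval_mul, eval_C, descPochhammer_eval_eq_descFactorial,
      Nat.descFactorial_eq_factorial_mul_choose]
    push_cast
    field_simp [hfac j]
  have htop : term n = descPochhammer ℂ n := by
    simp only [term]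
    rw [hn, surjColorings_card, div_self (hfac _), C_1, one_mul]
  have hdeg : (∑ j ∈ Finset.range n, term j).degree < (descPochhammer ℂ n).degree := by
    rw [degree_eq_natDegree (monic_descPochhammer ℂ n).ne_zero, descPochhammer_natDegree]
    refine mem_degreeLT.1 (Submodule.sum_mem _ ?_)
    intro j hj
    rw [mem_degreeLT]
    simp only [term, ← smul_eq_C_mul]
    refine lt_of_le_of_lt (degree_smul_le _ _) ?_
    rw [degree_eq_natDegree (monic_descPochhammer ℂ j).ne_zero, descPochhammer_natDegree]
    exact_mod_cast Finset.mem_range.1 hj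
  have hsum : ∑ j ∈ Finset.range (n + 1), term j =
      ∑ j ∈ Finset.range n, term j + descPochhammer ℂ n := by
    rw [Finset.sum_range_succ, htop]
  have hev : ∀ q : ℕ, (Nat.card (G.Coloring (Fin q)) : ℂ) =
      (∑ j ∈ Finset.range (n + 1), term j).eval (q : ℂ) := by
    intro q
    rw [eval_finsetSum, card_coloring_eq_sum]
    simp only [hterm]
    rw [← Nat.cast_sum]
    congr 1
    have h1 : ∑ j ∈ Finset.range (n + 1), q.choose j * surjColorings G j =
        ∑ j ∈ Finset.range (n + 1 + (q + 1)), q.choose j * surjColorings G j := by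
      refine Finset.sum_subset (Finset.range_mono (by omega)) fun j _ hj => ?_
      rw [surjColorings_eq_zero G (by simp at hj; omega), mul_zero]
    have h2 : ∑ j ∈ Finset.range (q + 1), q.choose j * surjColorings G j =
        ∑ j ∈ Finset.range (n + 1 + (q + 1)), q.choose j * surjColorings G j := by
      refine Finset.sum_subset (Finset.range_mono (by omega)) fun j _ hj => ?_
      rw [Nat.choose_eq_zero_of_lt (by simp at hj; omega), zero_mul]
    rw [h1, h2]
  refine ⟨∑ j ∈ Finset.range (n + 1), term j, ⟨?_, ?_, ?_⟩, ?_⟩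
  · rw [hsum]; exact (monic_descPochhammer ℂ n).add_of_right hdeg
  · rw [hsum, natDegree_add_eq_right_of_degree_lt hdeg, descPochhammer_natDegree]
  · exact fun q => (hev q).symm
  · intro χ hχ
    refine eq_of_infinite_eval_eq _ _ (Set.Infinite.mono ?_
      (Set.infinite_range_of_injective (Nat.cast_injective (R := ℂ))))
    rintro _ ⟨q, rfl⟩
    exact (hχ.2.2 q).trans (hev q)

/-- The chromatic polynomial `χ(G; q)`. -/
def chromaticPolynomial (G : SimpleGraph V) : ℂ[X] :=
  (existsUnique_isChromaticPolynomial G).choose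

theorem chromaticPolynomial_spec (G : SimpleGraph V) :
    IsChromaticPolynomial G (chromaticPolynomial G) :=
  (existsUnique_isChromaticPolynomial G).choose_spec.1

/-- The polynomial `P(G; z) = (-z)^|V| χ(G; -1/z)`. -/
def polyP (G : SimpleGraph V) : ℂ[X] :=
  ∑ k ∈ Finset.range (Fintype.card V + 1),
    C ((chromaticPolynomial G).coeff k) * (-X) ^ (Fintype.card V - k)

theorem eval_polyP (G : SimpleGraph V) {z : ℂ} (hz : z ≠ 0) :
    (polyP G).eval z = (-z) ^ Fintype.card V * (chromaticPolynomial G).eval (-1 / z) := by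
  rw [polyP, eval_finsetSum, eval_eq_sum_range, (chromaticPolynomial_spec G).2.1,
    Finset.mul_sum]
  refine Finset.sum_congr rfl fun k hk => ?_
  have hk' : k ≤ Fintype.card V := Nat.lt_succ_iff.1 (Finset.mem_range.1 hk)
  have hz' : -z ≠ 0 := neg_ne_zero.2 hz
  have h : (-1 / z : ℂ) = (-z)⁻¹ := by rw [neg_div, one_div, inv_neg]
  simp only [eval_mul, eval_C, eval_pow, eval_neg, eval_X]
  rw [pow_sub₀ _ hz' hk', h, inv_pow]
  ring

/-- The function `z ↦ log P(G; z)`, with the principal branch of the logarithm. -/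
def logP (G : SimpleGraph V) (z : ℂ) : ℂ :=
  Complex.log ((polyP G).eval z)

end Chromatic

/-- The `m`-th Taylor polynomial at `0`. -/
def taylorPolynomial (f : ℂ → ℂ) (m : ℕ) : ℂ[X] :=
  ∑ k ∈ Finset.range (m + 1), C (iteratedDeriv k f 0 / (k.factorial : ℂ)) * X ^ k

/-! ### The machine model

A random access machine. It has a fixed number `K` of registers and an unbounded word memory, all
holding natural numbers, on which it can add, subtract, test for zero and address indirectly.
It also has an unbounded coefficient memory holding rational numbers, on which it can carry out the
four arithmetic operations; no branch can depend on a coefficient. The input graph is read through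
its adjacency lists. Each elementary operation costs one unit of time. -/

/-- `adj` lists, for each vertex, all its neighbours, without repetition and in any order. -/
def IsAdjacencyList {n : ℕ} (G : SimpleGraph (Fin n)) (adj : Fin n → List (Fin n)) : Prop :=
  ∀ v, (adj v).Nodup ∧ ∀ w, w ∈ adj v ↔ G.Adj v w

/-- The (read-only) input: the number of vertices `n`, the number `m`, the adjacency lists. -/
structure Input where
  n : ℕ
  m : ℕ
  adj : Fin n → List (Fin n)

/-- The number of neighbours of `v` (`0` if `v` is not a vertex). -/
def Input.degree (I : Input) (v : ℕ) : ℕ :=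
  if h : v < I.n then (I.adj ⟨v, h⟩).length else 0

/-- The `i`-th entry of the adjacency list of `v`, counted from `0` (`0` if there is none). -/
def Input.neighbor (I : Input) (v i : ℕ) : ℕ :=
  if h : v < I.n then
    if h' : i < (I.adj ⟨v, h⟩).length then ((I.adj ⟨v, h⟩)[i] : ℕ) else 0
  else 0

/-- Memory contents. -/
@[ext]
structure State (K : ℕ) where
  reg : Fin K → ℕ
  word : ℕ → ℕ
  coeff : ℕ → ℚ

/-- All registers and memory cells hold `0`. -/
def State.init (K : ℕ) : State K := ⟨fun _ => 0, fun _ => 0, fun _ => 0⟩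

/-- Expressions for natural numbers. -/
inductive Expr (K : ℕ) : Type
  | num (c : ℕ)
  | inputN
  | inputM
  | degree (v : Expr K)
  | neighbor (v i : Expr K)
  | reg (r : Fin K)
  | load (a : Expr K)
  | add (e f : Expr K)
  | sub (e f : Expr K)

/-- The value of an expression; subtraction is truncated at `0`. -/
def Expr.eval {K : ℕ} (I : Input) (s : State K) : Expr K → ℕ
  | num c => c
  | inputN => I.n
  | inputM => I.m
  | degree v => I.degree (v.eval I s)
  | neighbor v i => I.neighbor (v.eval I s) (i.eval I s)
  | reg r => s.reg r
  | load a => s.word (a.eval I s)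
  | add e f => e.eval I s + f.eval I s
  | sub e f => e.eval I s - f.eval I s

/-- The time for evaluating an expression: one unit for each of its nodes. -/
def Expr.time {K : ℕ} : Expr K → ℕ
  | num _ => 1
  | inputN => 1
  | inputM => 1
  | degree v => v.time + 1
  | neighbor v i => v.time + i.time + 1
  | reg _ => 1
  | load a => a.time + 1
  | add e f => e.time + f.time + 1
  | sub e f => e.time + f.time + 1

/-- Arithmetic operations on coefficients. -/
inductive ArithOp : Type
  | add
  | sub
  | mul
  | div

/-- The value of an arithmetic operation. -/
def ArithOp.apply : ArithOp → ℚ → ℚ → ℚ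
  | add, x, y => x + y
  | sub, x, y => x - y
  | mul, x, y => x * y
  | div, x, y => x / y

/-- Commands. -/
inductive Cmd (K : ℕ) : Type
  /-- do nothing -/
  | skip
  /-- register `r` receives the value of `e` -/
  | assign (r : Fin K) (e : Expr K)
  /-- word cell `a` receives the value of `e` -/
  | store (a e : Expr K)
  /-- coefficient cell `a` receives the constant `c` -/
  | const (a : Expr K) (c : ℚ)
  /-- coefficient cell `a` receives the result of `op` on the coefficient cells `b` and `c` -/
  | arith (op : ArithOp) (a b c : Expr K)
  /-- first `p`, then `q` -/
  | seq (p q : Cmd K)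
  /-- `p` if `e` is not zero, `q` if it is -/
  | ite (e : Expr K) (p q : Cmd K)
  /-- repeat `p` while `e` is not zero -/
  | loop (e : Expr K) (p : Cmd K)
  /-- call the procedure with number `i` -/
  | call (i : ℕ)

/-- A program: a fixed number of registers, a finite list of procedures, and a main command. -/
structure Program where
  regs : ℕ
  procs : List (Cmd regs)
  main : Cmd regs

/-- `Exec I procs p s t s'`: on input `I`, command `p` started in state `s` halts in state `s'` after
time `t`. Division by zero and a call of a procedure that does not exist block the computation.
A procedure starts with the register contents of the caller, whose registers are restored when it
returns, while the memories are shared; besides the time for its body, a call costs `K + 1`, for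
saving the `K` registers and for the jump. -/
inductive Exec {K : ℕ} (I : Input) (procs : List (Cmd K)) :
    Cmd K → State K → ℕ → State K → Prop
  | skip (s : State K) : Exec I procs .skip s 1 s
  | assign (r : Fin K) (e : Expr K) (s : State K) :
      Exec I procs (.assign r e) s (e.time + 1)
        { s with reg := Function.update s.reg r (e.eval I s) }
  | store (a e : Expr K) (s : State K) :
      Exec I procs (.store a e) s (a.time + e.time + 1)
        { s with word := Function.update s.word (a.eval I s) (e.eval I s) }
  | const (a : Expr K) (c : ℚ) (s : State K) :
      Exec I procs (.const a c) s (a.time + 1)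
        { s with coeff := Function.update s.coeff (a.eval I s) c }
  | arith (op : ArithOp) (a b c : Expr K) (s : State K)
      (h : op = .div → s.coeff (c.eval I s) ≠ 0) :
      Exec I procs (.arith op a b c) s (a.time + b.time + c.time + 1)
        { s with coeff := Function.update s.coeff (a.eval I s)
                  (op.apply (s.coeff (b.eval I s)) (s.coeff (c.eval I s))) }
  | seq {p q : Cmd K} {s s₁ s₂ : State K} {t₁ t₂ : ℕ}
      (hp : Exec I procs p s t₁ s₁) (hq : Exec I procs q s₁ t₂ s₂) :
      Exec I procs (.seq p q) s (t₁ + t₂) s₂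
  | ite_true {e : Expr K} {p q : Cmd K} {s s₁ : State K} {t : ℕ}
      (he : e.eval I s ≠ 0) (hp : Exec I procs p s t s₁) :
      Exec I procs (.ite e p q) s (e.time + 1 + t) s₁
  | ite_false {e : Expr K} {p q : Cmd K} {s s₁ : State K} {t : ℕ}
      (he : e.eval I s = 0) (hq : Exec I procs q s t s₁) :
      Exec I procs (.ite e p q) s (e.time + 1 + t) s₁
  | loop_done {e : Expr K} {p : Cmd K} {s : State K} (he : e.eval I s = 0) :
      Exec I procs (.loop e p) s (e.time + 1) s
  | loop_step {e : Expr K} {p : Cmd K} {s s₁ s₂ : State K} {t₁ t₂ : ℕ}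
      (he : e.eval I s ≠ 0) (hp : Exec I procs p s t₁ s₁)
      (hl : Exec I procs (.loop e p) s₁ t₂ s₂) :
      Exec I procs (.loop e p) s (e.time + 1 + t₁ + t₂) s₂
  | call {i : ℕ} {p : Cmd K} {s s₁ : State K} {t : ℕ}
      (hi : procs[i]? = some p) (hp : Exec I procs p s t s₁) :
      Exec I procs (.call i) s (K + 1 + t) { s₁ with reg := s.reg }

/-- A computation determines its running time and its result. -/
theorem Exec.deterministic {K : ℕ} {I : Input} {procs : List (Cmd K)} {p : Cmd K}
    {s s₁ : State K} {t₁ : ℕ} (h₁ : Exec I procs p s t₁ s₁) :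
    ∀ {t₂ : ℕ} {s₂ : State K}, Exec I procs p s t₂ s₂ → t₁ = t₂ ∧ s₁ = s₂ := by
  induction h₁ with
  | skip s => intro _ _ h; cases h; exact ⟨rfl, rfl⟩
  | assign r e s => intro _ _ h; cases h; exact ⟨rfl, rfl⟩
  | store a e s => intro _ _ h; cases h; exact ⟨rfl, rfl⟩
  | const a c s => intro _ _ h; cases h; exact ⟨rfl, rfl⟩
  | arith op a b c s _ => intro _ _ h; cases h; exact ⟨rfl, rfl⟩
  | seq _ _ ihp ihq =>
    intro _ _ h
    cases h with
    | seq hp' hq' =>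
      obtain ⟨rfl, rfl⟩ := ihp hp'
      obtain ⟨rfl, rfl⟩ := ihq hq'
      exact ⟨rfl, rfl⟩
  | ite_true he _ ih =>
    intro _ _ h
    cases h with
    | ite_true _ hp' => obtain ⟨rfl, rfl⟩ := ih hp'; exact ⟨rfl, rfl⟩
    | ite_false he' _ => exact absurd he' he
  | ite_false he _ ih =>
    intro _ _ h
    cases h with
    | ite_true he' _ => exact absurd he he'
    | ite_false _ hq' => obtain ⟨rfl, rfl⟩ := ih hq'; exact ⟨rfl, rfl⟩
  | loop_done he =>
    intro _ _ h
    cases h with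
    | loop_done _ => exact ⟨rfl, rfl⟩
    | loop_step he' _ _ => exact absurd he he'
  | loop_step he _ _ ihp ihl =>
    intro _ _ h
    cases h with
    | loop_done he' => exact absurd he' he
    | loop_step _ hp' hl' =>
      obtain ⟨rfl, rfl⟩ := ihp hp'
      obtain ⟨rfl, rfl⟩ := ihl hl'
      exact ⟨rfl, rfl⟩
  | call hi _ ih =>
    intro _ _ h
    cases h with
    | call hi' hp' =>
      rw [hi] at hi'
      cases hi'
      obtain ⟨rfl, rfl⟩ := ih hp'
      exact ⟨rfl, rfl⟩

/-- On input `I` the program `A`, started with zeros in all registers and memory cells, halts after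
time `t` with memory contents `s`. -/
def Program.HaltsIn (A : Program) (I : Input) (t : ℕ) (s : State A.regs) : Prop :=
  Exec I A.procs A.main (State.init A.regs) t s

/-- The output: the polynomial of degree at most `m` whose coefficients stand in the coefficient
cells `0, …, m`. -/
def State.output {K : ℕ} (s : State K) (m : ℕ) : ℂ[X] :=
  ∑ k ∈ Finset.range (m + 1), C ((s.coeff k : ℚ) : ℂ) * X ^ k

end ChromaticTaylor

end

namespace ChromaticTaylor

/-! ### Deletion and contraction at an extra vertex -/

section Contraction

/-! Since P(G; -1/q) = χ(G; q) / q^|V|, identities between the polynomials P follow from counting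
colourings. In this normalisation isolated vertices contribute the factor 1, and
deletion–contraction of an edge e reads P(H) = P(H - e) + z P(H / e).

Write P(D, L) for `polyP (coneGraph G D L)` and N(u) for the neighbours of u. Deleting or
contracting the edge from the extra vertex to u gives P(D, L ∪ {u}) = P(D, L) + z P(D ∪ {u}, N(u) ∪
L) (`polyP_coneGraph_insert`), and P(D ∪ {u}, N(u)) = P(D, ∅) because the extra vertex then plays
the role of u (`polyP_coneGraph_neighborSet`). Hence the quotients R(D, L) = P(D, L) / P(D, ∅)
satisfy the closed recursion R(D, L ∪ {u}) = R(D, L) + z R(D ∪ {u}, N(u) ∪ L) / R(D ∪ {u}, N(u)).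
The factor z means that the last two quotients are needed only to one order less, so at most m
vertices are ever put into D. `quotSeries` is this truncated recursion and `agreeTo_quotSeries` its
correctness.

Removing the vertices in their order writes P(G) as the product over v of R({0, …, v}, N(v)). So z
P' / P is a sum of logarithmic derivatives (`agreeTo_sum_eulerLog`), and its k-th coefficient is k
times that of log P (`taylor_log_eval`).

For order k and a list of length l the recursion is dominated by (3eΔ)^k (1 + 1/Δ)^l, up to a factor
of order m²Δ (`seriesTime_step`). The rest verifies a program for it in a weakest-precondition
style: `seriesSpec` for the recursive procedure, `program_spec` for the whole. -/

theorem eval_polyP_neg_inv {V : Type*} [Fintype V] (G : SimpleGraph V) (q : ℕ) :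
    (polyP G).eval (-1 / ((q + 1 : ℕ) : ℂ)) =
      Nat.card (G.Coloring (Fin (q + 1))) / ((q + 1 : ℕ) : ℂ) ^ Fintype.card V := by
  have hq : ((q + 1 : ℕ) : ℂ) ≠ 0 := Nat.cast_ne_zero.2 (Nat.succ_ne_zero q)
  have h2 : (-1 / (-1 / ((q + 1 : ℕ) : ℂ))) = ((q + 1 : ℕ) : ℂ) := by
    field_simp
  rw [eval_polyP G (div_ne_zero (by norm_num) hq), h2, (chromaticPolynomial_spec G).2.2,
    neg_div, neg_neg, div_pow, one_pow]
  ring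

/-- The points -1/(q + 1) are infinitely many; shifting q by one avoids division by zero. -/
theorem eq_of_eval_neg_inv {P Q : ℂ[X]}
    (h : ∀ q : ℕ, P.eval (-1 / ((q + 1 : ℕ) : ℂ)) = Q.eval (-1 / ((q + 1 : ℕ) : ℂ))) : P = Q := by
  refine eq_of_infinite_eval_eq _ _ (Set.Infinite.mono ?_
    (Set.infinite_range_of_injective (f := fun q : ℕ => (-1 / ((q + 1 : ℕ) : ℂ))) ?_))
  · rintro _ ⟨q, rfl⟩
    exact h q
  · intro a b hab
    have ha : ((a + 1 : ℕ) : ℂ) ≠ 0 := Nat.cast_ne_zero.2 (Nat.succ_ne_zero a)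
    have hb : ((b + 1 : ℕ) : ℂ) ≠ 0 := Nat.cast_ne_zero.2 (Nat.succ_ne_zero b)
    have : ((a + 1 : ℕ) : ℂ) = ((b + 1 : ℕ) : ℂ) := by
      simp only at hab
      field_simp at hab
      simpa using hab.symm
    exact Nat.succ_injective (Nat.cast_injective this)

theorem polyP_coeff_zero {V : Type*} [Fintype V] (G : SimpleGraph V) : (polyP G).coeff 0 = 1 := by
  rw [coeff_zero_eq_eval_zero, polyP, eval_finsetSum, Finset.sum_range_succ,
    Finset.sum_eq_zero]
  · have := (chromaticPolynomial_spec G).1.coeff_natDegree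
    rw [(chromaticPolynomial_spec G).2.1] at this
    simp [this]
  · intro k hk
    have : Fintype.card V - k ≠ 0 := by
      have := Finset.mem_range.1 hk
      omega
    simp [this]

/-- `G - D` together with an extra vertex, adjacent to the vertices of `L` outside `D`. The
vertices of `D` are kept as isolated vertices, on which `P` does not depend. -/
def coneGraph {V : Type*} (G : SimpleGraph V) (D L : Set V) : SimpleGraph (Option V) where
  Adj
    | some a, some b => G.Adj a b ∧ a ∉ D ∧ b ∉ D
    | some a, none => a ∈ L ∧ a ∉ D
    | none, some b => b ∈ L ∧ b ∉ D
    | none, none => False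
  symm := ⟨by
    rintro (_ | a) (_ | b) h
    · exact h
    · exact h
    · exact h
    · exact ⟨h.1.symm, h.2.2, h.2.1⟩⟩
  loopless := ⟨by
    rintro (_ | a) h
    · exact h
    · exact G.loopless.irrefl a h.1⟩

variable {V : Type*} (G : SimpleGraph V) (D L : Set V)

@[simp] theorem coneGraph_some_some (a b : V) :
    (coneGraph G D L).Adj (some a) (some b) ↔ G.Adj a b ∧ a ∉ D ∧ b ∉ D := Iff.rfl
@[simp] theorem coneGraph_some_none (a : V) :
    (coneGraph G D L).Adj (some a) none ↔ a ∈ L ∧ a ∉ D := Iff.rfl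
@[simp] theorem coneGraph_none_some (b : V) :
    (coneGraph G D L).Adj none (some b) ↔ b ∈ L ∧ b ∉ D := Iff.rfl
@[simp] theorem coneGraph_none_none : ¬ (coneGraph G D L).Adj none none := id

/-- Colourings of `coneGraph G D L` as functions. -/
def IsConeColoring {V : Type*} (G : SimpleGraph V) (D L : Set V) {q : ℕ} (f : Option V → Fin q) :
    Prop :=
  (∀ a b, G.Adj a b → a ∉ D → b ∉ D → f (some a) ≠ f (some b)) ∧
    ∀ a ∈ L, a ∉ D → f none ≠ f (some a)

theorem card_coneGraph_coloring (q : ℕ) :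
    Nat.card ((coneGraph G D L).Coloring (Fin q)) =
      Nat.card {f : Option V → Fin q // IsConeColoring G D L f} := by
  refine Nat.card_congr
    { toFun := fun c => ⟨c, fun a b h ha hb => c.valid ⟨h, ha, hb⟩,
        fun a h ha => c.valid (v := none) (w := some a) ⟨h, ha⟩⟩
      invFun := fun f => SimpleGraph.Coloring.mk f.1 ?_
      left_inv := fun c => DFunLike.ext _ _ fun v => rfl
      right_inv := fun f => rfl }
  rintro (_ | a) (_ | b) h
  · exact h.elim
  · exact f.2.2 b h.1 h.2
  · exact (f.2.2 a h.1 h.2).symm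
  · exact f.2.1 a b h.1 h.2.1 h.2.2

/-- This is why the algorithm may skip entries that are removed or repeated. -/
theorem coneGraph_insert_of_mem {u : V} (h : u ∈ D ∨ u ∈ L) :
    coneGraph G D (insert u L) = coneGraph G D L := by
  ext a b
  rcases a with _ | a <;> rcases b with _ | b <;> simp <;> grind

variable [Fintype V]

/-- Deletion–contraction of the edge from the extra vertex to `u`. The contracted graph keeps `u` as
an isolated vertex with a free colour, hence the factor `q` on the other terms. -/
theorem card_coneGraph_insert {u : V} (hu : u ∉ D) (huL : u ∉ L) (q : ℕ) :
    q * Nat.card ((coneGraph G D L).Coloring (Fin q)) =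
      q * Nat.card ((coneGraph G D (insert u L)).Coloring (Fin q)) +
        Nat.card ((coneGraph G (insert u D) (G.neighborSet u ∪ L)).Coloring (Fin q)) := by
  classical
  simp only [card_coneGraph_coloring]
  -- Split according to whether the extra vertex and `u` have different colours.
  have e1 : {f : Option V → Fin q // IsConeColoring G D L f} ≃
      {f : Option V → Fin q // IsConeColoring G D (insert u L) f} ⊕
        {f : Option V → Fin q // IsConeColoring G D L f ∧ f none = f (some u)} := by
    refine ((Equiv.sumCompl fun f : {f : Option V → Fin q // IsConeColoring G D L f} =>
      f.1 none ≠ f.1 (some u)).symm).trans (Equiv.sumCongr ?_ ?_)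
    · refine (Equiv.subtypeSubtypeEquivSubtypeInter (IsConeColoring G D L)
        fun f : Option V → Fin q => f none ≠ f (some u)).trans (Equiv.subtypeEquivRight fun f => ?_)
      constructor
      · rintro ⟨⟨h1, h2⟩, h3⟩
        refine ⟨h1, fun a ha haD => ?_⟩
        rcases ha with rfl | ha
        · exact h3
        · exact h2 a ha haD
      · rintro ⟨h1, h2⟩
        exact ⟨⟨h1, fun a ha => h2 a (Or.inr ha)⟩, h2 u (Or.inl rfl) hu⟩
    · refine (Equiv.subtypeSubtypeEquivSubtypeInter (IsConeColoring G D L)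
        fun f : Option V → Fin q => ¬ f none ≠ f (some u)).trans
          (Equiv.subtypeEquivRight fun f => ?_)
      simp
  -- If the colours agree, the extra vertex can carry the constraints of `u` as well; the colour of
  -- `u` becomes redundant and is overwritten by an arbitrary one. The inverse resets it to that of
  -- the extra vertex.
  have e2 : Fin q × {f : Option V → Fin q // IsConeColoring G D L f ∧ f none = f (some u)} ≃
      {f : Option V → Fin q // IsConeColoring G (insert u D) (G.neighborSet u ∪ L) f} :=
    { toFun := fun p => ⟨Function.update p.2.1 (some u) p.1, by
        obtain ⟨x, f, ⟨h1, h2⟩, h3⟩ := p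
        refine ⟨fun a b hab ha hb => ?_, fun a ha haD => ?_⟩
        · have ha' : a ≠ u := fun h => ha (Or.inl h)
          have hb' : b ≠ u := fun h => hb (Or.inl h)
          simpa [Function.update, ha', hb'] using
            h1 a b hab (fun h => ha (Or.inr h)) (fun h => hb (Or.inr h))
        · have ha' : a ≠ u := fun h => haD (Or.inl h)
          have : f none ≠ f (some a) := by
            rcases ha with ha | ha
            · rw [h3]; exact h1 u a ha hu (fun h => haD (Or.inr h))
            · exact h2 a ha (fun h => haD (Or.inr h))
          simpa [Function.update, ha'] using this⟩
      invFun := fun f => (f.1 (some u), ⟨Function.update f.1 (some u) (f.1 none), by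
        obtain ⟨f, h1, h2⟩ := f
        have key : ∀ a, G.Adj u a → a ∉ D → f none ≠ f (some a) := fun a h ha =>
          h2 a (Or.inl h) (fun h' => by
            rcases h' with rfl | h'
            · exact G.loopless.irrefl _ h
            · exact ha h')
        refine ⟨⟨fun a b hab ha hb => ?_, fun a ha haD => ?_⟩, ?_⟩
        · by_cases ha' : a = u
          · subst ha'
            have hb' : b ≠ a := hab.ne'
            simpa [Function.update, hb'] using key b hab hb
          · by_cases hb' : b = u
            · subst hb'
              simpa [Function.update, ha'] using (key a hab.symm ha).symm
            · simpa [Function.update, ha', hb'] using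
                h1 a b hab (by simp [ha', ha]) (by simp [hb', hb])
        · have ha' : a ≠ u := fun h => huL (h ▸ ha)
          simpa [Function.update, ha'] using h2 a (Or.inr ha) (by simp [ha', haD])
        · simp [Function.update]⟩)
      left_inv := by
        rintro ⟨x, f, h, h3⟩
        ext
        · simp
        · simp [Function.update, h3]
          grind
      right_inv := by
        rintro ⟨f, h⟩
        ext
        simp [Function.update]
        grind }
  rw [← Nat.card_congr e2, Nat.card_prod, Nat.card_fin, Nat.card_congr e1, Nat.card_sum, mul_add]

theorem polyP_coneGraph_insert {u : V} (hu : u ∉ D) (huL : u ∉ L) :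
    polyP (coneGraph G D (insert u L)) =
      polyP (coneGraph G D L) + X * polyP (coneGraph G (insert u D) (G.neighborSet u ∪ L)) := by
  refine eq_of_eval_neg_inv fun q => ?_
  have hq : ((q + 1 : ℕ) : ℂ) ≠ 0 := Nat.cast_ne_zero.2 (Nat.succ_ne_zero q)
  have h := card_coneGraph_insert G D L hu huL (q + 1)
  simp only [eval_add, eval_mul, eval_X, eval_polyP_neg_inv]
  generalize q + 1 = r at *
  have h' := congrArg (Nat.cast (R := ℂ)) h
  rw [Nat.cast_mul, Nat.cast_add, Nat.cast_mul] at h'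
  field_simp
  linear_combination -h'

theorem card_coloring_of_iso {W W' : Type*} {H : SimpleGraph W} {H' : SimpleGraph W'} (e : H ≃g H')
    (q : ℕ) : Nat.card (H.Coloring (Fin q)) = Nat.card (H'.Coloring (Fin q)) := by
  refine Nat.card_congr
    { toFun := fun c => c.comp e.symm.toHom
      invFun := fun c => c.comp e.toHom
      left_inv := fun c => DFunLike.ext _ _ fun v => ?_
      right_inv := fun c => DFunLike.ext _ _ fun v => ?_ }
  · change c (e.symm (e v)) = c v
    rw [e.symm_apply_apply]
  · change c (e (e.symm v)) = c v
    rw [e.apply_symm_apply]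

/-- The extra vertex can take the place of `u`. -/
theorem polyP_coneGraph_neighborSet {u : V} (hu : u ∉ D) :
    polyP (coneGraph G (insert u D) (G.neighborSet u)) = polyP (coneGraph G D ∅) := by
  classical
  have e : coneGraph G (insert u D) (G.neighborSet u) ≃g coneGraph G D ∅ :=
    { toEquiv := Equiv.swap none (some u)
      map_rel_iff' := by
        have h1 := G.loopless.irrefl
        have h2 := fun a b => G.adj_comm a b
        rintro (_ | a) (_ | b)
        · simp
        · by_cases hb : b = u
          · subst hb; simp
          · rw [Equiv.swap_apply_left, Equiv.swap_apply_of_ne_of_ne (by simp) (by simpa using hb)]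
            simp [hu, hb]
        · by_cases hb : a = u
          · subst hb; simp
          · rw [Equiv.swap_apply_left, Equiv.swap_apply_of_ne_of_ne (by simp) (by simpa using hb)]
            simp [hu, hb, h2 a u]
        · by_cases ha : a = u <;> by_cases hb : b = u
          · subst ha; subst hb; simp
          · subst ha
            rw [Equiv.swap_apply_right, Equiv.swap_apply_of_ne_of_ne (by simp) (by simpa using hb)]
            simp
          · subst hb
            rw [Equiv.swap_apply_right, Equiv.swap_apply_of_ne_of_ne (by simp) (by simpa using ha)]
            simp
          · rw [Equiv.swap_apply_of_ne_of_ne (by simp) (by simpa using ha),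
              Equiv.swap_apply_of_ne_of_ne (by simp) (by simpa using hb)]
            simp [ha, hb] }
  refine eq_of_eval_neg_inv fun q => ?_
  rw [eval_polyP_neg_inv, eval_polyP_neg_inv, card_coloring_of_iso e]

theorem polyP_coneGraph_univ : polyP (coneGraph G Set.univ ∅) = 1 := by
  refine eq_of_eval_neg_inv fun q => ?_
  have hq : ((q + 1 : ℕ) : ℂ) ≠ 0 := Nat.cast_ne_zero.2 (Nat.succ_ne_zero q)
  have : Nat.card {f : Option V → Fin (q + 1) // IsConeColoring G Set.univ ∅ f} =
      (q + 1) ^ Fintype.card (Option V) := by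
    rw [Nat.card_congr (Equiv.subtypeUnivEquiv fun f => by simp [IsConeColoring]),
      Nat.card_fun, Nat.card_fin, Nat.card_eq_fintype_card]
  rw [eval_polyP_neg_inv, card_coneGraph_coloring, this, eval_one, Nat.cast_pow,
    div_self (pow_ne_zero _ hq)]

theorem polyP_coneGraph_empty : polyP (coneGraph G ∅ ∅) = polyP G := by
  refine eq_of_eval_neg_inv fun q => ?_
  have hq : ((q + 1 : ℕ) : ℂ) ≠ 0 := Nat.cast_ne_zero.2 (Nat.succ_ne_zero q)
  have e : {f : Option V → Fin (q + 1) // IsConeColoring G ∅ ∅ f} ≃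
      Fin (q + 1) × G.Coloring (Fin (q + 1)) :=
    { toFun := fun f => (f.1 none, SimpleGraph.Coloring.mk (fun v => f.1 (some v))
        fun {a b} h => f.2.1 a b h id id)
      invFun := fun c => ⟨fun v => v.elim c.1 c.2, fun a b h _ _ => c.2.valid h,
        fun a h => h.elim⟩
      left_inv := by
        rintro ⟨f, h⟩
        ext v
        rcases v with _ | v <;> rfl
      right_inv := fun c => Prod.ext rfl (DFunLike.ext _ _ fun v => rfl) }
  rw [eval_polyP_neg_inv, eval_polyP_neg_inv, card_coneGraph_coloring, Nat.card_congr e,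
    Nat.card_prod, Nat.card_fin, Fintype.card_option, Nat.cast_mul, pow_succ']
  exact mul_div_mul_left _ _ hq

end Contraction


/-! ### Power series modulo `X ^ k` -/

section PowerSeriesModulo

open PowerSeries

/-- Agreement of two power series up to and including the coefficient of `X ^ k`. -/
def AgreeTo {R : Type*} [Semiring R] (k : ℕ) (f g : R⟦X⟧) : Prop :=
  ∀ i ≤ k, PowerSeries.coeff i f = PowerSeries.coeff i g

section Ring

variable {R : Type*} [CommRing R] {k : ℕ} {f g f' g' : R⟦X⟧}

theorem AgreeTo.refl (f : R⟦X⟧) : AgreeTo k f f := fun _ _ => rfl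

theorem AgreeTo.symm (h : AgreeTo k f g) : AgreeTo k g f := fun i hi => (h i hi).symm

theorem AgreeTo.add (h : AgreeTo k f g) (h' : AgreeTo k f' g') : AgreeTo k (f + f') (g + g') :=
  fun i hi => by simp [h i hi, h' i hi]

theorem AgreeTo.mul (h : AgreeTo k f g) (h' : AgreeTo k f' g') : AgreeTo k (f * f') (g * g') :=
  fun i hi => by
    rw [PowerSeries.coeff_mul, PowerSeries.coeff_mul]
    refine Finset.sum_congr rfl fun p hp => ?_
    have := Finset.HasAntidiagonal.mem_antidiagonal.1 hp
    rw [h p.1 (by omega), h' p.2 (by omega)]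

/-- The gain of one order that makes the recursion terminate. -/
theorem AgreeTo.X_mul (h : AgreeTo k f g) :
    AgreeTo (k + 1) (PowerSeries.X * f) (PowerSeries.X * g) := fun i hi => by
  rcases i with _ | i
  · simp
  · rw [PowerSeries.coeff_succ_X_mul, PowerSeries.coeff_succ_X_mul, h i (by omega)]

theorem coeff_X_mul_derivative (f : R⟦X⟧) (i : ℕ) :
    PowerSeries.coeff i (PowerSeries.X * d⁄dX R f) = i * PowerSeries.coeff i f := by
  rcases i with _ | i
  · simp
  · rw [PowerSeries.coeff_succ_X_mul, PowerSeries.coeff_derivative]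
    push_cast
    ring

/-- Differentiation loses one order; the factor `X` restores it. -/
theorem AgreeTo.X_mul_derivative (h : AgreeTo k f g) :
    AgreeTo k (PowerSeries.X * d⁄dX R f) (PowerSeries.X * d⁄dX R g) := fun i hi => by
  rw [coeff_X_mul_derivative, coeff_X_mul_derivative, h i hi]

end Ring

section Field

variable {K : Type*} [Field K] {k : ℕ} {f g : K⟦X⟧}

theorem AgreeTo.constantCoeff_ne_zero (h : AgreeTo k f g)
    (hg : PowerSeries.constantCoeff g ≠ 0) : PowerSeries.constantCoeff f ≠ 0 := by
  have := h 0 (Nat.zero_le _)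
  simp only [PowerSeries.coeff_zero_eq_constantCoeff] at this
  rwa [this]

theorem AgreeTo.inv (h : AgreeTo k f g) (hg : PowerSeries.constantCoeff g ≠ 0) :
    AgreeTo k f⁻¹ g⁻¹ := by
  have hf := h.constantCoeff_ne_zero hg
  have e1 : f⁻¹ = f⁻¹ * g⁻¹ * g := by
    rw [mul_assoc, PowerSeries.inv_mul_cancel g hg, mul_one]
  have e2 : g⁻¹ = f⁻¹ * g⁻¹ * f := by
    rw [mul_comm f⁻¹, mul_assoc, PowerSeries.inv_mul_cancel f hf, mul_one]
  have h3 := (AgreeTo.refl (k := k) (f⁻¹ * g⁻¹)).mul h.symm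
  rwa [← e1, ← e2] at h3

/-- Long division, as the division procedure carries it out; the constant coefficient 1 makes every
pivot trivial. -/
theorem coeff_mul_inv (hg : PowerSeries.constantCoeff g = 1) (f : K⟦X⟧) (i : ℕ) :
    PowerSeries.coeff i (f * g⁻¹) = PowerSeries.coeff i f - ∑ j ∈ Finset.range i,
      PowerSeries.coeff (j + 1) g * PowerSeries.coeff (i - (j + 1)) (f * g⁻¹) := by
  have h : f = g * (f * g⁻¹) := by
    rw [mul_left_comm, PowerSeries.mul_inv_cancel g (by rw [hg]; exact one_ne_zero), mul_one]
  have h' := congrArg (PowerSeries.coeff i) h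
  rw [PowerSeries.coeff_mul, Finset.Nat.sum_antidiagonal_eq_sum_range_succ
    (fun a b => PowerSeries.coeff a g * PowerSeries.coeff b (f * g⁻¹)), Finset.sum_range_succ',
    PowerSeries.coeff_zero_eq_constantCoeff_apply, hg, one_mul, Nat.sub_zero] at h'
  rw [h', add_sub_cancel_left]

theorem map_inv_of_ne_zero {F : Type*} [Field F] (φ : K →+* F)
    (hf : PowerSeries.constantCoeff f ≠ 0) :
    PowerSeries.map φ f⁻¹ = (PowerSeries.map φ f)⁻¹ := by
  have h' : PowerSeries.constantCoeff (PowerSeries.map φ f) ≠ 0 := by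
    rw [← PowerSeries.coeff_zero_eq_constantCoeff_apply, PowerSeries.coeff_map,
      PowerSeries.coeff_zero_eq_constantCoeff_apply]
    exact (map_ne_zero φ).2 hf
  rw [PowerSeries.eq_inv_iff_mul_eq_one h', ← map_mul, PowerSeries.inv_mul_cancel f hf, map_one]

/-- The series `X f' / f`. -/
noncomputable def eulerLog (f : K⟦X⟧) : K⟦X⟧ := PowerSeries.X * d⁄dX K f * f⁻¹

theorem eulerLog_one : eulerLog (1 : K⟦X⟧) = 0 := by
  simp [eulerLog]

theorem AgreeTo.eulerLog (h : AgreeTo k f g) (hg : PowerSeries.constantCoeff g ≠ 0) :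
    AgreeTo k (eulerLog f) (eulerLog g) :=
  h.X_mul_derivative.mul (h.inv hg)

theorem eulerLog_mul_inv (hf : PowerSeries.constantCoeff f ≠ 0)
    (hg : PowerSeries.constantCoeff g ≠ 0) : eulerLog (f * g⁻¹) = eulerLog f - eulerLog g := by
  have hf' := PowerSeries.mul_inv_cancel f hf
  have hg' := PowerSeries.mul_inv_cancel g hg
  have hi : (g⁻¹)⁻¹ = g := by
    rw [PowerSeries.inv_eq_iff_mul_eq_one (by simpa using hg), hg']
  simp only [ChromaticTaylor.eulerLog, PowerSeries.mul_inv_rev, hi, Derivation.leibniz, smul_eq_mul,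
    PowerSeries.derivative_inv']
  linear_combination (PowerSeries.X * d⁄dX K f * f⁻¹ - PowerSeries.X * d⁄dX K g * g⁻¹ * (f * f⁻¹))
    * hg' - (PowerSeries.X * d⁄dX K g * g⁻¹) * hf'

theorem map_eulerLog {F : Type*} [Field F] (φ : K →+* F) (hf : PowerSeries.constantCoeff f ≠ 0) :
    PowerSeries.map φ (ChromaticTaylor.eulerLog f) =
      ChromaticTaylor.eulerLog (PowerSeries.map φ f) := by
  rw [ChromaticTaylor.eulerLog, ChromaticTaylor.eulerLog, map_mul, map_inv_of_ne_zero φ hf]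
  congr 1
  ext i
  rw [PowerSeries.coeff_map, coeff_X_mul_derivative, coeff_X_mul_derivative, map_mul, map_natCast,
    PowerSeries.coeff_map]

end Field

end PowerSeriesModulo

/-! ### The Taylor coefficients of the logarithm -/

section Analytic

open scoped PowerSeries

theorem iteratedDeriv_eval (p : ℂ[X]) (k : ℕ) :
    iteratedDeriv k (fun z => p.eval z) = fun z => (derivative^[k] p).eval z := by
  induction k with
  | zero => simp
  | succ k ih =>
    rw [iteratedDeriv_succ, ih, Function.iterate_succ_apply']
    ext z
    exact Polynomial.deriv _

theorem iteratedDeriv_eval_zero (p : ℂ[X]) (k : ℕ) :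
    iteratedDeriv k (fun z => p.eval z) 0 = k.factorial * p.coeff k := by
  rw [iteratedDeriv_eval]
  simp only [← coeff_zero_eq_eval_zero, coeff_iterate_derivative, zero_add,
    Nat.descFactorial_self, nsmul_eq_mul]

theorem analyticAt_eval (p : ℂ[X]) : AnalyticAt ℂ (fun z => p.eval z) 0 := by
  simpa using AnalyticAt.aeval_polynomial (analyticAt_id (𝕜 := ℂ) (z := (0 : ℂ))) p

theorem analyticAt_log_eval {p : ℂ[X]} (hp : p.coeff 0 = 1) :
    AnalyticAt ℂ (fun z => Complex.log (p.eval z)) 0 := by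
  refine (analyticAt_eval p).clog ?_
  rw [← coeff_zero_eq_eval_zero, hp]
  exact Complex.one_mem_slitPlane

/-- The formal Taylor series φ of log p satisfies φ' p = p', so X φ' is `eulerLog p`. -/
theorem taylor_log_eval {p : ℂ[X]} (hp : p.coeff 0 = 1) (k : ℕ) :
    k * (iteratedDeriv k (fun z => Complex.log (p.eval z)) 0 / (k.factorial : ℂ)) =
      PowerSeries.coeff k (eulerLog (p : PowerSeries ℂ)) := by
  set f : ℂ → ℂ := fun z => Complex.log (p.eval z) with hf
  set φ : PowerSeries ℂ := PowerSeries.mk fun k => iteratedDeriv k f 0 / (k.factorial : ℂ) with hφ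
  have hfac : ∀ j : ℕ, ((j.factorial : ℕ) : ℂ) ≠ 0 := fun j =>
    Nat.cast_ne_zero.2 (Nat.factorial_ne_zero j)
  have han : AnalyticAt ℂ f 0 := analyticAt_log_eval hp
  -- The identity (log p)' p = p' holds near 0, where p stays in the slit plane. Comparing k-th
  -- derivatives at 0 by the Leibniz rule turns it into an identity of power series.
  have hev : (deriv f * fun z => p.eval z) =ᶠ[nhds 0] fun z => (derivative p).eval z := by
    have hs : ∀ᶠ z in nhds (0 : ℂ), p.eval z ∈ Complex.slitPlane := by
      refine (p.continuous.continuousAt).eventually_mem (Complex.isOpen_slitPlane.mem_nhds ?_)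
      rw [← coeff_zero_eq_eval_zero, hp]
      exact Complex.one_mem_slitPlane
    filter_upwards [hs] with z hz
    have hd : HasDerivAt f ((derivative p).eval z / p.eval z) z := (p.hasDerivAt z).clog hz
    rw [Pi.mul_apply, hd.deriv, div_mul_cancel₀ _ (Complex.slitPlane_ne_zero hz)]
  have key : d⁄dX ℂ φ * (p : PowerSeries ℂ) = d⁄dX ℂ (p : PowerSeries ℂ) := by
    ext k
    have h1 := hev.iteratedDeriv_eq k
    rw [iteratedDeriv_mul han.deriv.contDiffAt (analyticAt_eval p).contDiffAt,
      iteratedDeriv_eval_zero] at h1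
    rw [PowerSeries.derivative_coe, Polynomial.coeff_coe, PowerSeries.coeff_mul,
      Finset.Nat.sum_antidiagonal_eq_sum_range_succ_mk, ← mul_right_inj' (hfac k), ← h1,
      Finset.mul_sum]
    refine Finset.sum_congr rfl fun j hj => ?_
    have hj' : j ≤ k := Nat.lt_succ_iff.1 (Finset.mem_range.1 hj)
    rw [PowerSeries.coeff_derivative, hφ, PowerSeries.coeff_mk, Polynomial.coeff_coe,
      iteratedDeriv_succ', iteratedDeriv_eval_zero, Nat.factorial_succ,
      ← Nat.choose_mul_factorial_mul_factorial hj']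
    have := hfac j
    have h3 : ((j : ℂ) + 1) ≠ 0 := Nat.cast_add_one_ne_zero j
    push_cast
    field_simp
  have hp' : PowerSeries.constantCoeff (p : PowerSeries ℂ) ≠ 0 := by
    rw [← PowerSeries.coeff_zero_eq_constantCoeff_apply, Polynomial.coeff_coe, hp]
    exact one_ne_zero
  rw [eulerLog, ← key, mul_assoc, mul_assoc, PowerSeries.mul_inv_cancel _ hp', mul_one,
    coeff_X_mul_derivative, hφ, PowerSeries.coeff_mk]

end Analytic

/-! ### The recursion for the quotients `P(D, L) / P(D, ∅)` -/

section Recursion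

open PowerSeries

variable {n : ℕ} (adj : Fin n → List (Fin n)) (v : ℕ)

/-- The series computed by the algorithm. The vertices up to `v` and those of `D` are removed, the
list `L` contains the neighbours of the extra vertex, and `k` is the order. -/
noncomputable def quotSeries : ℕ → List (Fin n) → List (Fin n) → ℚ⟦X⟧
  | 0, _, _ => 1
  | _ + 1, _, [] => 1
  | k + 1, D, u :: L =>
    quotSeries (k + 1) D L +
      if (u : ℕ) ≤ v ∨ u ∈ L ∨ u ∈ D then 0 else
        PowerSeries.X * (quotSeries k (u :: D) (adj u ++ L) * (quotSeries k (u :: D) (adj u))⁻¹)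
termination_by k _ L => (k, L.length)

theorem constantCoeff_quotSeries (k : ℕ) (D L : List (Fin n)) :
    PowerSeries.constantCoeff (quotSeries adj v k D L) = 1 := by
  rcases k with _ | k
  · simp [quotSeries]
  · induction L with
    | nil => simp [quotSeries]
    | cons u L ih =>
      rw [quotSeries, map_add, ih]
      split_ifs <;> simp

/-- `P` of the cone graph with the vertices up to `v` removed, as a power series. -/
noncomputable def coneSeries (G : SimpleGraph (Fin n)) (D L : Set (Fin n)) : ℂ⟦X⟧ :=
  (polyP (coneGraph G D L) : ℂ[X])

theorem constantCoeff_coneSeries (G : SimpleGraph (Fin n)) (D L : Set (Fin n)) :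
    PowerSeries.constantCoeff (coneSeries G D L) = 1 := by
  rw [coneSeries, ← PowerSeries.coeff_zero_eq_constantCoeff_apply, Polynomial.coeff_coe,
    polyP_coeff_zero]

variable {adj} in
-- Outer induction on the order, inner induction on the list; `D` together with the vertices up to
-- `v` is the removed set.
theorem agreeTo_quotSeries {G : SimpleGraph (Fin n)} (hadj : IsAdjacencyList G adj) (k : ℕ)
    (D L : List (Fin n)) :
    AgreeTo k (PowerSeries.map (algebraMap ℚ ℂ) (quotSeries adj v k D L))
      (coneSeries G {x | (x : ℕ) ≤ v ∨ x ∈ D} {x | x ∈ L} *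
        (coneSeries G {x | (x : ℕ) ≤ v ∨ x ∈ D} ∅)⁻¹) := by
  have hne : ∀ D L, PowerSeries.constantCoeff (coneSeries G D L) ≠ 0 := fun D L => by
    rw [constantCoeff_coneSeries]; exact one_ne_zero
  induction k generalizing D L with
  | zero =>
    intro i hi
    obtain rfl : i = 0 := by omega
    simp [quotSeries, constantCoeff_coneSeries]
  | succ k ihk =>
    induction L with
    | nil =>
      have : {x : Fin n | x ∈ ([] : List (Fin n))} = ∅ := by simp
      rw [this, PowerSeries.mul_inv_cancel _ (hne _ _), quotSeries, map_one]
      exact AgreeTo.refl _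
    | cons u L ihL =>
      have hset : {x | x ∈ u :: L} = insert u {x | x ∈ L} := by ext; simp
      rw [quotSeries, map_add, hset]
      split_ifs with h
      · rw [map_zero, add_zero]
        have : coneSeries G {x | (x : ℕ) ≤ v ∨ x ∈ D} (insert u {x | x ∈ L}) =
            coneSeries G {x | (x : ℕ) ≤ v ∨ x ∈ D} {x | x ∈ L} := by
          rw [coneSeries, coneSeries, coneGraph_insert_of_mem]
          simp only [Set.mem_ofPred_eq]
          tauto
        rw [this]
        exact ihL
      · push Not at h
        have huD : u ∉ {x : Fin n | (x : ℕ) ≤ v ∨ x ∈ D} := by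
          simp only [Set.mem_ofPred_eq]
          rintro (h' | h')
          · omega
          · exact h.2.2 h'
        set D' : Set (Fin n) := {x | (x : ℕ) ≤ v ∨ x ∈ D} with hD'
        have hD : {x : Fin n | (x : ℕ) ≤ v ∨ x ∈ u :: D} = insert u D' := by
          ext x
          simp only [hD', Set.mem_ofPred_eq, List.mem_cons, Set.mem_insert_iff]
          tauto
        have hN : {x | x ∈ adj u} = G.neighborSet u := by
          ext x
          simp [(hadj u).2 x]
        have hNL : {x | x ∈ adj u ++ L} = G.neighborSet u ∪ {x | x ∈ L} := by
          ext x
          simp [(hadj u).2 x]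
        have h1 : coneSeries G D' (insert u {x | x ∈ L}) = coneSeries G D' {x | x ∈ L} +
            PowerSeries.X * coneSeries G (insert u D') (G.neighborSet u ∪ {x | x ∈ L}) := by
          rw [coneSeries, polyP_coneGraph_insert G D' _ huD (by simpa using h.2.1)]
          simp [coneSeries]
        have h2 : coneSeries G (insert u D') (G.neighborSet u) = coneSeries G D' ∅ := by
          rw [coneSeries, polyP_coneGraph_neighborSet G D' huD, coneSeries]
        have hnum := ihk (u :: D) (adj u ++ L)
        have hden := ihk (u :: D) (adj u)
        rw [hD, hNL] at hnum
        rw [hD, hN, h2] at hden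
        have hE := hne (insert u D') ∅
        have hF := hne D' ∅
        have hq := hnum.mul (hden.inv (by simp [constantCoeff_coneSeries]))
        -- Both quotients have the denominator P(D ∪ {u}, ∅), which cancels; what remains is divided
        -- by P(D ∪ {u}, N(u)) = P(D, ∅).
        have hsimp : coneSeries G (insert u D') (G.neighborSet u ∪ {x | x ∈ L}) *
            (coneSeries G (insert u D') ∅)⁻¹ * (coneSeries G D' ∅ *
              (coneSeries G (insert u D') ∅)⁻¹)⁻¹ =
            coneSeries G (insert u D') (G.neighborSet u ∪ {x | x ∈ L}) *
              (coneSeries G D' ∅)⁻¹ := by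
          rw [PowerSeries.eq_mul_inv_iff_mul_eq hF, mul_assoc, mul_assoc, PowerSeries.mul_inv_rev]
          have hi : ((coneSeries G (insert u D') ∅)⁻¹)⁻¹ = coneSeries G (insert u D') ∅ := by
            rw [PowerSeries.inv_eq_iff_mul_eq_one (by simpa using hE),
              PowerSeries.mul_inv_cancel _ hE]
          rw [hi]
          linear_combination (coneSeries G (insert u D') (G.neighborSet u ∪ {x | x ∈ L}) *
            coneSeries G D' ∅ * (coneSeries G D' ∅)⁻¹) * PowerSeries.mul_inv_cancel _ hE +
            coneSeries G (insert u D') (G.neighborSet u ∪ {x | x ∈ L}) *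
              PowerSeries.mul_inv_cancel _ hF
        rw [hsimp] at hq
        rw [h1, add_mul, map_mul, map_mul, PowerSeries.map_X, mul_assoc, map_inv_of_ne_zero _
          (by rw [constantCoeff_quotSeries]; exact one_ne_zero)]
        exact ihL.add hq.X_mul

/-- The logarithmic derivative of `P(G; z)` is a sum over the vertices. -/
theorem agreeTo_sum_eulerLog {G : SimpleGraph (Fin n)} (hadj : IsAdjacencyList G adj) (k : ℕ) :
    AgreeTo k (PowerSeries.map (algebraMap ℚ ℂ)
        (∑ v : Fin n, eulerLog (quotSeries adj v k [] (adj v))))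
      (eulerLog ((polyP G : ℂ[X]) : ℂ⟦X⟧)) := by
  have hne : ∀ D L, PowerSeries.constantCoeff (coneSeries G D L) ≠ 0 := fun D L => by
    rw [constantCoeff_coneSeries]; exact one_ne_zero
  have hterm : ∀ v : Fin n, AgreeTo k (PowerSeries.map (algebraMap ℚ ℂ)
        (eulerLog (quotSeries adj v k [] (adj v))))
      (eulerLog (coneSeries G {x | (x : ℕ) < v} ∅) -
        eulerLog (coneSeries G {x | (x : ℕ) < v + 1} ∅)) := by
    intro v
    have hD : {x : Fin n | (x : ℕ) ≤ v ∨ x ∈ ([] : List (Fin n))} =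
        insert v {x : Fin n | (x : ℕ) < v} := by
      ext x
      simp [le_iff_eq_or_lt, Fin.ext_iff]
    have hD' : {x : Fin n | (x : ℕ) < v + 1} = insert v {x : Fin n | (x : ℕ) < v} := by
      ext x
      simp [le_iff_eq_or_lt, Fin.ext_iff]
    have hN : {x | x ∈ adj v} = G.neighborSet v := by
      ext x
      simp [(hadj v).2 x]
    have h := agreeTo_quotSeries (v : ℕ) hadj k [] (adj v)
    rw [hD, hN] at h
    have h2 : coneSeries G (insert v {x : Fin n | (x : ℕ) < v}) (G.neighborSet v) =
        coneSeries G {x : Fin n | (x : ℕ) < v} ∅ := by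
      rw [coneSeries, polyP_coneGraph_neighborSet G _ (by simp), coneSeries]
    rw [h2] at h
    rw [hD', map_eulerLog _ (by rw [constantCoeff_quotSeries]; exact one_ne_zero),
      ← eulerLog_mul_inv (hne _ _) (hne _ _)]
    exact h.eulerLog (by simp [constantCoeff_coneSeries])
  -- The sum telescopes from the whole graph, with value P(G), to the graph with all vertices
  -- removed, where P = 1.
  have htel : ∑ v : Fin n, (eulerLog (coneSeries G {x | (x : ℕ) < v} ∅) -
      eulerLog (coneSeries G {x | (x : ℕ) < v + 1} ∅)) = eulerLog ((polyP G : ℂ[X]) : ℂ⟦X⟧) := by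
    rw [Fin.sum_univ_eq_sum_range (fun v => eulerLog (coneSeries G {x | (x : ℕ) < v} ∅) -
      eulerLog (coneSeries G {x | (x : ℕ) < v + 1} ∅)) n, Finset.sum_range_sub']
    have h0 : {x : Fin n | (x : ℕ) < 0} = ∅ := by simp
    have h1 : {x : Fin n | (x : ℕ) < n} = Set.univ := by ext x; simp
    rw [h0, h1, coneSeries, coneSeries, polyP_coneGraph_empty, polyP_coneGraph_univ,
      Polynomial.coe_one, eulerLog_one, sub_zero]
  rw [← htel, map_sum]
  intro i hi
  rw [map_sum, map_sum]
  exact Finset.sum_congr rfl fun v _ => hterm v i hi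

theorem taylorPolynomial_logP {G : SimpleGraph (Fin n)} (hadj : IsAdjacencyList G adj) (m : ℕ) :
    taylorPolynomial (logP G) m = ∑ k ∈ Finset.range (m + 1),
      Polynomial.C (((PowerSeries.coeff k
        (∑ v : Fin n, eulerLog (quotSeries adj v m [] (adj v))) / k : ℚ)) : ℂ) *
        Polynomial.X ^ k := by
  refine Finset.sum_congr rfl fun k hk => ?_
  congr 2
  have h1 := taylor_log_eval (polyP_coeff_zero G) k
  have h2 := agreeTo_sum_eulerLog adj hadj m k (Nat.lt_succ_iff.1 (Finset.mem_range.1 hk))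
  rcases k with _ | k
  -- For k = 0 the left side is log 1 = 0, and the right side is a division by zero, which is 0 by
  -- convention.
  · simp [logP, ← Polynomial.coeff_zero_eq_eval_zero, polyP_coeff_zero]
  · have hk0 : ((k + 1 : ℕ) : ℂ) ≠ 0 := Nat.cast_ne_zero.2 (Nat.succ_ne_zero k)
    rw [← h2, PowerSeries.coeff_map] at h1
    rw [Rat.cast_div, Rat.cast_natCast, eq_div_iff hk0, mul_comm]
    exact h1

end Recursion


/-! ### Symbolic execution -/

section Execution

variable {K : ℕ} {I : Input} {procs : List (Cmd K)}

/-- Started in state `s`, the command `p` halts, and its running time and final state satisfy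
`Q`. -/
def wp (I : Input) (procs : List (Cmd K)) (p : Cmd K) (s : State K) (Q : ℕ → State K → Prop) :
    Prop :=
  ∃ t s', Exec I procs p s t s' ∧ Q t s'

theorem wp_mono {p : Cmd K} {s : State K} {Q Q' : ℕ → State K → Prop} (h : wp I procs p s Q)
    (hQ : ∀ t s', Q t s' → Q' t s') : wp I procs p s Q' := by
  obtain ⟨t, s', he, hq⟩ := h
  exact ⟨t, s', he, hQ t s' hq⟩

variable (I procs)

theorem wp_skip (s : State K) (Q : ℕ → State K → Prop) :
    wp I procs .skip s Q ↔ Q 1 s := by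
  refine ⟨?_, fun h => ⟨_, _, .skip s, h⟩⟩
  rintro ⟨t, s', he, hq⟩
  cases he
  exact hq

theorem wp_assign (r : Fin K) (e : Expr K) (s : State K) (Q : ℕ → State K → Prop) :
    wp I procs (.assign r e) s Q ↔
      Q (e.time + 1) { s with reg := Function.update s.reg r (e.eval I s) } := by
  refine ⟨?_, fun h => ⟨_, _, .assign r e s, h⟩⟩
  rintro ⟨t, s', he, hq⟩
  cases he
  exact hq

theorem wp_store (a e : Expr K) (s : State K) (Q : ℕ → State K → Prop) :
    wp I procs (.store a e) s Q ↔ Q (a.time + e.time + 1)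
      { s with word := Function.update s.word (a.eval I s) (e.eval I s) } := by
  refine ⟨?_, fun h => ⟨_, _, .store a e s, h⟩⟩
  rintro ⟨t, s', he, hq⟩
  cases he
  exact hq

theorem wp_const (a : Expr K) (c : ℚ) (s : State K) (Q : ℕ → State K → Prop) :
    wp I procs (.const a c) s Q ↔ Q (a.time + 1)
      { s with coeff := Function.update s.coeff (a.eval I s) c } := by
  refine ⟨?_, fun h => ⟨_, _, .const a c s, h⟩⟩
  rintro ⟨t, s', he, hq⟩
  cases he
  exact hq

theorem wp_arith (op : ArithOp) (a b c : Expr K) (s : State K) (Q : ℕ → State K → Prop) :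
    wp I procs (.arith op a b c) s Q ↔ (op = .div → s.coeff (c.eval I s) ≠ 0) ∧
      Q (a.time + b.time + c.time + 1)
      { s with coeff := Function.update s.coeff (a.eval I s)
                  (op.apply (s.coeff (b.eval I s)) (s.coeff (c.eval I s))) } := by
  refine ⟨?_, fun h => ⟨_, _, .arith op a b c s h.1, h.2⟩⟩
  rintro ⟨t, s', he, hq⟩
  cases he with
  | arith _ _ _ _ _ h => exact ⟨h, hq⟩

theorem wp_seq (p q : Cmd K) (s : State K) (Q : ℕ → State K → Prop) :
    wp I procs (.seq p q) s Q ↔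
      wp I procs p s fun t s' => wp I procs q s' fun t' s'' => Q (t + t') s'' := by
  constructor
  · rintro ⟨t, s', he, hq⟩
    cases he with
    | seq hp' hq' => exact ⟨_, _, hp', _, _, hq', hq⟩
  · rintro ⟨t, s', hp, t', s'', hq, h⟩
    exact ⟨_, _, .seq hp hq, h⟩

theorem wp_ite (e : Expr K) (p q : Cmd K) (s : State K) (Q : ℕ → State K → Prop) :
    wp I procs (.ite e p q) s Q ↔
      (e.eval I s = 0 → wp I procs q s fun t s' => Q (e.time + 1 + t) s') ∧
      (e.eval I s ≠ 0 → wp I procs p s fun t s' => Q (e.time + 1 + t) s') := by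
  constructor
  · rintro ⟨t, s', he, hq⟩
    cases he with
    | ite_true h hp => exact ⟨fun h' => absurd h' h, fun _ => ⟨_, _, hp, hq⟩⟩
    | ite_false h hp => exact ⟨fun _ => ⟨_, _, hp, hq⟩, fun h' => absurd h h'⟩
  · rintro ⟨h0, h1⟩
    by_cases h : e.eval I s = 0
    · obtain ⟨t, s', he, hq⟩ := h0 h
      exact ⟨_, _, .ite_false h he, hq⟩
    · obtain ⟨t, s', he, hq⟩ := h1 h
      exact ⟨_, _, .ite_true h he, hq⟩

theorem wp_call {i : ℕ} {p : Cmd K} (hi : procs[i]? = some p) {s : State K}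
    {Q : ℕ → State K → Prop}
    (h : wp I procs p s fun t s' => Q (K + 1 + t) { s' with reg := s.reg }) :
    wp I procs (.call i) s Q := by
  obtain ⟨t, s', he, hq⟩ := h
  exact ⟨_, _, .call hi he, hq⟩

/-- A loop whose number of remaining rounds is known. -/
theorem wp_loop {e : Expr K} {p : Cmd K} (Inv : ℕ → State K → Prop) (T : ℕ)
    (h0 : ∀ s, Inv 0 s → e.eval I s = 0)
    (hstep : ∀ j s, Inv (j + 1) s →
      e.eval I s ≠ 0 ∧ wp I procs p s fun t s' => t ≤ T ∧ Inv j s')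
    (j : ℕ) (s : State K) (h : Inv j s) :
    wp I procs (.loop e p) s fun t s' => t ≤ (j + 1) * (T + e.time + 1) ∧ Inv 0 s' := by
  induction j generalizing s with
  | zero => exact ⟨_, _, .loop_done (h0 s h), by ring_nf; omega, h⟩
  | succ j ih =>
    obtain ⟨he, t, s', hp, ht, hi⟩ := hstep j s h
    obtain ⟨t', s'', hl, ht', hi'⟩ := ih s' hi
    refine ⟨_, _, .loop_step he hp hl, ?_, hi'⟩
    rw [add_mul (j + 1), one_mul]
    omega

end Execution

/-! ### Linked lists -/

section Lists

/-- In the memory `w`, below the address `b`, there is a linked list with entries `l` at `p`: the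
value of a node is followed by the address of the next node, the empty list is at `0`. -/
def ListAt (w : ℕ → ℕ) (b : ℕ) : ℕ → List ℕ → Prop
  | p, [] => p = 0
  | p, a :: l => p ≠ 0 ∧ p + 1 < b ∧ w p = a ∧ ListAt w b (w (p + 1)) l

/-- All nodes lie below the bound, so writing at or above the free pointer leaves older lists
intact. This lets lists share tails and survive recursive calls. -/
theorem ListAt.congr {w w' : ℕ → ℕ} {b b' : ℕ} (hb : b ≤ b') (hw : ∀ a < b, w' a = w a)
    {p : ℕ} {l : List ℕ} (h : ListAt w b p l) : ListAt w' b' p l := by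
  induction l generalizing p with
  | nil => exact h
  | cons a l ih =>
    obtain ⟨h1, h2, h3, h4⟩ := h
    refine ⟨h1, by omega, by rw [hw p (by omega), h3], ?_⟩
    rw [hw (p + 1) h2]
    exact ih h4

theorem ListAt.push {w w' : ℕ → ℕ} {b p a : ℕ} {l : List ℕ} (h : ListAt w b p l) (hb : b ≠ 0)
    (hw : ∀ a < b, w' a = w a) (h0 : w' b = a) (h1 : w' (b + 1) = p) :
    ListAt w' (b + 2) b (a :: l) :=
  ⟨hb, by omega, h0, by rw [h1]; exact h.congr (by omega) hw⟩

theorem ListAt.eq_zero_iff {w : ℕ → ℕ} {b p : ℕ} {l : List ℕ} (h : ListAt w b p l) :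
    p = 0 ↔ l = [] := by
  cases l with
  | nil => exact ⟨fun _ => rfl, fun _ => h⟩
  | cons a l => simp [h.1]

end Lists

/-! ### The program

The registers hold
* `0`: the order `k`,
* `1`: a list `L` of neighbours, `2`: a list `D` of removed vertices,
* `3`: the vertex `v` up to which all vertices are removed,
* `4`, `5`: the first free cells of the word memory and of the coefficient memory,
* `6`: a vertex `u`, `7`, `8`: addresses, `9`, `10`: counters. -/

section Program

/-- Adds the number of occurrences of `u` in the list `1` to the first free word. -/
def scanProc : Cmd 11 :=
  .loop (.reg 1) <|
    -- The sum of the two truncated differences is the distance of the entries, zero exactly when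
    -- they are equal.
    .seq (.ite (.add (.sub (.load (.reg 1)) (.reg 6)) (.sub (.reg 6) (.load (.reg 1)))) .skip
      (.store (.reg 4) (.add (.load (.reg 4)) (.num 1)))) <|
    .assign 1 (.load (.add (.reg 1) (.num 1)))

/-- Divides the series of order `k` at the address `7` by the one at the address `5`. -/
def divProc : Cmd 11 :=
  .loop (.sub (.add (.reg 0) (.num 1)) (.reg 9)) <|
    .seq (.assign 10 (.reg 9)) <|
    .seq (.loop (.reg 10) <|
      -- The product is kept in a scratch cell just behind the divisor.
      .seq (.arith .mul (.add (.add (.reg 5) (.reg 0)) (.num 1)) (.add (.reg 5) (.reg 10))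
        (.sub (.add (.reg 7) (.reg 9)) (.reg 10))) <|
      .seq (.arith .sub (.add (.reg 7) (.reg 9)) (.add (.reg 7) (.reg 9))
        (.add (.add (.reg 5) (.reg 0)) (.num 1))) <|
      .assign 10 (.sub (.reg 10) (.num 1))) <|
    .assign 9 (.add (.reg 9) (.num 1))

/-- Adds the series of order `k` at the address `7` to the one at the address `8`. -/
def addProc : Cmd 11 :=
  .seq (.assign 9 (.add (.reg 0) (.num 1))) <|
  .loop (.reg 9) <|
    .seq (.assign 9 (.sub (.reg 9) (.num 1))) <|
    .arith .add (.add (.reg 8) (.reg 9)) (.add (.reg 8) (.reg 9)) (.add (.reg 7) (.reg 9))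

/-- Puts the neighbours of `u` in front of the list `1`. -/
def pushCmd : Cmd 11 :=
  .seq (.assign 9 (.degree (.reg 6))) <|
  .loop (.reg 9) <|
    .seq (.assign 9 (.sub (.reg 9) (.num 1))) <|
    .seq (.store (.reg 4) (.neighbor (.reg 6) (.reg 9))) <|
    .seq (.store (.add (.reg 4) (.num 1)) (.reg 1)) <|
    .seq (.assign 1 (.reg 4)) <|
    .assign 4 (.add (.reg 4) (.num 2))

/-- The series `1` of order `k`. -/
def oneCmd : Cmd 11 :=
  .seq (.assign 9 (.reg 0)) <|
  .seq (.loop (.reg 9) <|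
    .seq (.const (.add (.reg 5) (.reg 9)) 0) <|
    .assign 9 (.sub (.reg 9) (.num 1))) <|
  .const (.reg 5) 1

/-- The contribution of a vertex `u` that is neither removed nor a repetition. -/
def branchCmd : Cmd 11 :=
  .seq (.store (.reg 4) (.reg 6)) <|
  .seq (.store (.add (.reg 4) (.num 1)) (.reg 2)) <|
  .seq (.assign 2 (.reg 4)) <|
  .seq (.assign 4 (.add (.reg 4) (.num 2))) <|
  -- Adding later at the address of coefficient 1 is the multiplication by `X`.
  .seq (.assign 8 (.add (.reg 5) (.num 1))) <|
  -- The numerator is placed behind the current series, whose order is still the old one here.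
  .seq (.assign 5 (.add (.add (.reg 5) (.reg 0)) (.num 1))) <|
  .seq (.assign 7 (.reg 5)) <|
  .seq (.assign 0 (.sub (.reg 0) (.num 1))) <|
  .seq pushCmd <|
  .seq (.call 0) <|
  -- The denominator goes behind the numerator, and its list starts again from the empty one.
  .seq (.assign 5 (.add (.add (.reg 5) (.reg 0)) (.num 1))) <|
  .seq (.assign 1 (.num 0)) <|
  .seq pushCmd <|
  .seq (.call 0) <|
  .seq (.call 2) <|
  .call 3

/-- The step of the recursion that removes the first entry of the list `1`. -/
def consCmd : Cmd 11 :=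
  .seq (.assign 6 (.load (.reg 1))) <|
  .seq (.assign 1 (.load (.add (.reg 1) (.num 1)))) <|
  .seq (.call 0) <|
  -- The truncated difference v + 1 - u is nonzero exactly if u ≤ v. The two scans add to the same
  -- cell, so it ends at 0 exactly if `u` is neither removed nor repeated.
  .seq (.store (.reg 4) (.sub (.add (.reg 3) (.num 1)) (.reg 6))) <|
  .seq (.call 1) <|
  .seq (.assign 7 (.reg 1)) <|
  .seq (.assign 1 (.reg 2)) <|
  .seq (.call 1) <|
  .seq (.assign 1 (.reg 7)) <|
  .ite (.load (.reg 4)) .skip branchCmd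

/-- Writes the coefficients of `quotSeries` to the address `5`. -/
def seriesProc : Cmd 11 :=
  .ite (.reg 0) (.ite (.reg 1) consCmd oneCmd) oneCmd

/-- The procedures. -/
def procedures : List (Cmd 11) := [seriesProc, scanProc, .seq (.assign 9 (.num 0)) divProc, addProc]

end Program

/-! ### Correctness and cost of the auxiliary procedures -/

section Procedures

variable (I : Input)

theorem scan_spec (s : State 11) (l : List ℕ) (hl : ListAt s.word (s.reg 4) (s.reg 1) l) :
    wp I procedures (.call 1) s fun t s' => t ≤ 40 * (l.length + 1) ∧ s' =
      { s with word := Function.update s.word (s.reg 4)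
                 (s.word (s.reg 4) + l.count (s.reg 6)) } := by
  refine wp_call I procedures (p := scanProc) rfl ?_
  -- The invariant: counter plus occurrences in the unread rest `l'` is constant. The counter cell
  -- lies above all nodes of the list.
  refine wp_mono (wp_loop I procedures (fun j s₁ => ∃ l' x, l'.length = j ∧
    ListAt s.word (s.reg 4) (s₁.reg 1) l' ∧ s₁.reg 4 = s.reg 4 ∧ s₁.reg 6 = s.reg 6 ∧
    s₁.coeff = s.coeff ∧ s₁.word = Function.update s.word (s.reg 4) x ∧
    x + l'.count (s.reg 6) = s.word (s.reg 4) + l.count (s.reg 6)) 25 ?_ ?_ l.length s ?_) ?_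
  · rintro s₁ ⟨l', x, h1, h2, -⟩
    rw [List.length_eq_zero_iff] at h1
    subst h1
    exact h2
  · rintro j s₁ ⟨l', x, h1, h2, h3, h4, h5, h6, h7⟩
    cases l' with
    | nil => simp at h1
    | cons a l' =>
      obtain ⟨ha, hb, hc, hd⟩ := h2
      refine ⟨ha, ?_⟩
      have hw1 : s₁.word (s₁.reg 1) = a := by
        rw [h6, Function.update_of_ne (by omega), hc]
      have hw2 : s₁.word (s₁.reg 1 + 1) = s.word (s₁.reg 1 + 1) := by
        rw [h6, Function.update_of_ne (by omega)]
      have hw3 : s₁.word (s₁.reg 4) = x := by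
        rw [h6, h3, Function.update_self]
      simp only [wp_seq, wp_ite, Expr.eval, hw1, h4]
      refine ⟨fun hu => ?_, fun hu => ?_⟩
      · have hu' : a = s.reg 6 := by omega
        simp only [wp_store, wp_assign, Expr.eval, Expr.time, hw3]
        refine ⟨by norm_num, l', x + 1, by simpa using h1, ?_, by simpa [Function.update] using h3,
          by simpa [Function.update] using h4, h5, ?_, ?_⟩
        · have : Function.update s₁.word (s₁.reg 4) (x + 1) (s₁.reg 1 + 1) =
            s.word (s₁.reg 1 + 1) := by rw [Function.update_of_ne (by omega), hw2]
          simpa [this] using hd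
        · rw [h6, h3, Function.update_idem]
        · rw [List.count_cons] at h7
          simp [hu'] at h7
          omega
      · have hu' : a ≠ s.reg 6 := by omega
        simp only [wp_skip, wp_assign, Expr.eval, Expr.time]
        refine ⟨by norm_num, l', x, by simpa using h1, ?_, by simpa [Function.update] using h3,
          by simpa [Function.update] using h4, h5, h6, ?_⟩
        · simpa [hw2] using hd
        · rw [List.count_cons] at h7
          simpa [hu'] using h7
  · exact ⟨l, s.word (s.reg 4), rfl, hl, rfl, rfl, rfl, by simp, rfl⟩
  · rintro t s₁ ⟨ht, l', x, h1, h2, h3, h4, h5, h6, h7⟩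
    rw [List.length_eq_zero_iff] at h1
    subst h1
    refine ⟨?_, ?_⟩
    · simp only [Expr.time] at ht
      omega
    · simp only [List.count_nil, add_zero] at h7
      ext : 1
      · rfl
      · rw [h6, h7]
      · exact h5

theorem push_spec (s : State 11) (u : Fin I.n) (l : List ℕ) (hu : s.reg 6 = u) (hb : s.reg 4 ≠ 0)
    (hl : ListAt s.word (s.reg 4) (s.reg 1) l) :
    wp I procedures pushCmd s fun t s' => t ≤ 40 * ((I.adj u).length + 1) ∧
      s.reg 4 ≤ s'.reg 4 ∧ ListAt s'.word (s'.reg 4) (s'.reg 1) ((I.adj u).map Fin.val ++ l) ∧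
      (∀ a < s.reg 4, s'.word a = s.word a) ∧ s'.coeff = s.coeff ∧
      ∀ r, r ≠ 1 → r ≠ 4 → r ≠ 9 → s'.reg r = s.reg r := by
  rw [pushCmd, wp_seq, wp_assign]
  -- Counting down pushes the last neighbour first, so the list ends up in the original order.
  refine wp_mono (wp_loop I procedures (fun j s₁ => j ≤ (I.adj u).length ∧ s₁.reg 9 = j ∧
      s.reg 4 ≤ s₁.reg 4 ∧
      ListAt s₁.word (s₁.reg 4) (s₁.reg 1) (((I.adj u).map Fin.val).drop j ++ l) ∧
      (∀ a < s.reg 4, s₁.word a = s.word a) ∧ s₁.coeff = s.coeff ∧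
      ∀ r, r ≠ 1 → r ≠ 4 → r ≠ 9 → s₁.reg r = s.reg r) 25 ?_ ?_ (I.adj u).length _ ?_) ?_
  · rintro s₁ ⟨-, h, -⟩
    exact h
  · rintro j s₁ ⟨h0, h1, h2, h3, h4, h5, h6⟩
    have hu₁ : s₁.reg 6 = u := by rw [h6 6 (by decide) (by decide) (by decide), hu]
    have hnb : I.neighbor u j = ((I.adj u).map Fin.val)[j]'(by simpa using h0) := by
      have h0' : j < (I.adj u).length := h0
      simp [Input.neighbor, h0']
    refine ⟨by simp [Expr.eval, h1], ?_⟩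
    simp only [wp_seq, wp_assign, wp_store, Expr.eval, Expr.time]
    simp only [Function.update_apply, Fin.isValue, Fin.reduceEq, if_true, if_false, h1, hu₁,
      Nat.add_sub_cancel]
    refine ⟨by norm_num, by omega, trivial, by omega, ?_, fun a ha => ?_, h5, fun r h r4 r9 => ?_⟩
    · rw [List.drop_eq_getElem_cons (by simpa using h0), ← hnb, List.cons_append]
      exact h3.push (by omega)
        (fun a ha => by rw [Function.update_of_ne (by omega), Function.update_of_ne (by omega)])
        (by simp [Function.update]) (by simp [Function.update])
    · rw [if_neg (by omega), if_neg (by omega), h4 a ha]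
    · rw [if_neg r4, if_neg h, if_neg r9]
      exact h6 r h r4 r9
  · refine ⟨le_rfl, ?_, le_rfl, ?_, fun _ _ => rfl, rfl, fun r _ _ h9 => Function.update_of_ne h9 _ _⟩
    · simp [Expr.eval, hu, Input.degree]
    · rw [List.drop_of_length_le (by simp)]
      simpa using hl
  · rintro t s₁ ⟨ht, -, -, h2, h3, h4⟩
    refine ⟨?_, h2, by simpa using h3, h4⟩
    simp only [Expr.time] at ht ⊢
    omega

theorem add_spec (s : State 11) (h : s.reg 8 + s.reg 0 < s.reg 7) :
    wp I procedures (.call 3) s fun t s' => t ≤ 40 * (s.reg 0 + 2) ∧ s'.reg = s.reg ∧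
      s'.word = s.word ∧
      (∀ i ≤ s.reg 0, s'.coeff (s.reg 8 + i) = s.coeff (s.reg 8 + i) + s.coeff (s.reg 7 + i)) ∧
      ∀ a, a < s.reg 8 ∨ s.reg 8 + s.reg 0 < a → s'.coeff a = s.coeff a := by
  refine wp_call I procedures (p := addProc) rfl ?_
  rw [addProc, wp_seq, wp_assign]
  refine wp_mono (wp_loop I procedures (fun j s₁ => j ≤ s.reg 0 + 1 ∧ s₁.reg 9 = j ∧
      s₁.reg 8 = s.reg 8 ∧ s₁.reg 7 = s.reg 7 ∧ s₁.word = s.word ∧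
      (∀ i ≤ s.reg 0, j ≤ i → s₁.coeff (s.reg 8 + i) =
        s.coeff (s.reg 8 + i) + s.coeff (s.reg 7 + i)) ∧
      ∀ a, a < s.reg 8 + j ∨ s.reg 8 + s.reg 0 < a → s₁.coeff a = s.coeff a)
      14 ?_ ?_ (s.reg 0 + 1) _ ?_) ?_
  · rintro s₁ ⟨-, h, -⟩
    exact h
  · rintro j s₁ ⟨h0, h1, h2, h3, h4, h5, h6⟩
    refine ⟨by simp [Expr.eval, h1], ?_⟩
    simp only [wp_seq, wp_assign, wp_arith, Expr.eval, Expr.time, ArithOp.apply]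
    simp only [Function.update_apply, Fin.isValue, Fin.reduceEq, if_true, if_false, h1, h2, h3,
      Nat.add_sub_cancel]
    refine ⟨by simp, by norm_num, by omega, trivial, trivial, trivial, h4, fun i hi hij => ?_, fun a ha => ?_⟩
    · rcases hij.eq_or_lt with rfl | hij
      · rw [if_pos rfl, h6 _ (by omega), h6 _ (by omega)]
      · rw [if_neg (by omega), h5 i hi hij]
    · rw [if_neg (by omega), h6 a (by omega)]
  · refine ⟨le_rfl, by simp [Expr.eval], rfl, rfl, rfl, fun i h1 h2 => by omega, fun _ _ => rfl⟩
  · rintro t s₁ ⟨ht, -, -, -, -, h4, h5, h6⟩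
    refine ⟨?_, rfl, h4, fun i hi => h5 i hi (Nat.zero_le _), fun a ha => h6 a (by simpa using ha)⟩
    simp only [Expr.time] at ht ⊢
    omega

/-- The division is done in place: before round b the cells below index b hold the quotient, the
others still the numerator. -/
theorem div_spec (s : State 11) (f g : PowerSeries ℚ) (h : s.reg 7 + s.reg 0 < s.reg 5)
    (hf : ∀ i ≤ s.reg 0, s.coeff (s.reg 7 + i) = PowerSeries.coeff i f)
    (hg : ∀ i ≤ s.reg 0, s.coeff (s.reg 5 + i) = PowerSeries.coeff i g)
    (hg0 : PowerSeries.constantCoeff g = 1) :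
    wp I procedures (.call 2) s fun t s' => t ≤ 100 * (s.reg 0 + 2) ^ 2 ∧ s'.reg = s.reg ∧
      s'.word = s.word ∧
      (∀ i ≤ s.reg 0, s'.coeff (s.reg 7 + i) = PowerSeries.coeff i (f * g⁻¹)) ∧
      ∀ a < s.reg 7, s'.coeff a = s.coeff a := by
  refine wp_call I procedures (p := .seq (.assign 9 (.num 0)) divProc) rfl ?_
  rw [wp_seq, wp_assign, divProc]
  refine wp_mono (wp_loop I procedures (fun j s₁ => ∃ b, b + j = s.reg 0 + 1 ∧ s₁.reg 9 = b ∧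
      s₁.reg 7 = s.reg 7 ∧ s₁.reg 5 = s.reg 5 ∧ s₁.reg 0 = s.reg 0 ∧ s₁.word = s.word ∧
      (∀ i < b, s₁.coeff (s.reg 7 + i) = PowerSeries.coeff i (f * g⁻¹)) ∧
      (∀ i ≤ s.reg 0, b ≤ i → s₁.coeff (s.reg 7 + i) = PowerSeries.coeff i f) ∧
      (∀ i ≤ s.reg 0, s₁.coeff (s.reg 5 + i) = PowerSeries.coeff i g) ∧
      ∀ a < s.reg 7, s₁.coeff a = s.coeff a)
      (40 * (s.reg 0 + 2)) ?_ ?_ (s.reg 0 + 1) _ ?_) ?_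
  · rintro s₁ ⟨b, hb, h1, h2, h3, h4, h5⟩
    simp only [Expr.eval]
    omega
  · rintro j s₁ ⟨b, hb, h1, h2, h3, h4, h5, h6, h7, h8, h9⟩
    refine ⟨by simp only [Expr.eval]; omega, ?_⟩
    rw [wp_seq, wp_assign, wp_seq]
    -- The cell of index b holds a partial remainder from which the i terms of `coeff_mul_inv` with
    -- l < i are still to be subtracted.
    refine wp_mono (wp_loop I procedures (fun i s₂ => i ≤ b ∧ s₂.reg 10 = i ∧ s₂.reg 9 = b ∧
      s₂.reg 7 = s.reg 7 ∧ s₂.reg 5 = s.reg 5 ∧ s₂.reg 0 = s.reg 0 ∧ s₂.word = s.word ∧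
      (∀ i < b, s₂.coeff (s.reg 7 + i) = PowerSeries.coeff i (f * g⁻¹)) ∧
      s₂.coeff (s.reg 7 + b) - ∑ l ∈ Finset.range i, PowerSeries.coeff (l + 1) g *
        PowerSeries.coeff (b - (l + 1)) (f * g⁻¹) = PowerSeries.coeff b (f * g⁻¹) ∧
      (∀ i ≤ s.reg 0, b < i → s₂.coeff (s.reg 7 + i) = PowerSeries.coeff i f) ∧
      (∀ i ≤ s.reg 0, s₂.coeff (s.reg 5 + i) = PowerSeries.coeff i g) ∧
      ∀ a < s.reg 7, s₂.coeff a = s.coeff a) 36 ?_ ?_ b _ ?_) ?_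
    · rintro s₂ ⟨-, h, -⟩
      exact h
    · rintro i s₂ ⟨k0, k1, k2, k3, k4, k5, k6, k7, k8, k9, k10, k11⟩
      refine ⟨by simp [Expr.eval, k1], ?_⟩
      simp only [wp_seq, wp_assign, wp_arith, Expr.eval, Expr.time, ArithOp.apply]
      simp only [Function.update_apply, Fin.isValue, Fin.reduceEq, if_true, if_false, k1, k2, k3,
        k4, k5, Nat.add_sub_cancel]
      refine ⟨by simp, by simp, by norm_num, by omega, trivial, trivial, trivial, trivial,
        trivial, k6,
        fun l hl => ?_, ?_, fun l hl hbl => ?_, fun l hl => ?_, fun a ha => ?_⟩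
      · rw [if_neg (by omega), if_neg (by omega), k7 l hl]
      · rw [if_neg (by omega), k10 (i + 1) (by omega), add_tsub_assoc_of_le (by omega),
          k7 (b - (i + 1)) (by omega), ← k8, Finset.sum_range_succ]
        ring
      · rw [if_neg (by omega), if_neg (by omega), k9 l hl hbl]
      · rw [if_neg (by omega), if_neg (by omega), k10 l hl]
      · rw [if_neg (by omega), if_neg (by omega), k11 a ha]
    · refine ⟨le_rfl, by simp [Expr.eval, h1], h1, h2, h3, h4, h5, h6, ?_,
        fun i hi hib => h7 i hi hib.le, h8, h9⟩
      rw [h7 b (by omega) le_rfl, ← coeff_mul_inv hg0]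
    · rintro t s₂ ⟨ht, -, k1, k2, k3, k4, k5, k6, k7, k8, k9, k10, k11⟩
      simp only [wp_assign, Expr.eval, Expr.time]
      simp only [Function.update_apply, Fin.isValue, Fin.reduceEq, if_true, if_false, k2]
      simp only [Expr.time] at ht
      refine ⟨by nlinarith, b + 1, by omega, rfl, k3, k4, k5, k6, fun i hi => ?_,
        fun i hi hbi => k9 i hi hbi, k10, k11⟩
      rcases Nat.lt_succ_iff_lt_or_eq.1 hi with hi | rfl
      · exact k7 i hi
      · rw [← k8, Finset.sum_range_zero, sub_zero]
  · exact ⟨0, by omega, rfl, rfl, rfl, rfl, rfl, fun i hi => by omega, fun i hi _ => hf i hi, hg,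
      fun _ _ => rfl⟩
  · rintro t s₁ ⟨ht, b, hb, h1, h2, h3, h4, h5, h6, h7, h8, h9⟩
    refine ⟨?_, rfl, h5, fun i hi => h6 i (by omega), h9⟩
    simp only [Expr.time] at ht ⊢
    nlinarith

theorem one_spec (s : State 11) :
    wp I procedures oneCmd s fun t s' => t ≤ 20 * (s.reg 0 + 2) ∧ s'.word = s.word ∧
      (∀ i ≤ s.reg 0, s'.coeff (s.reg 5 + i) = PowerSeries.coeff i 1) ∧
      ∀ a < s.reg 5, s'.coeff a = s.coeff a := by
  rw [oneCmd, wp_seq, wp_assign, wp_seq]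
  refine wp_mono (wp_loop I procedures (fun j s₁ => j ≤ s.reg 0 ∧ s₁.reg 9 = j ∧
      s₁.reg 5 = s.reg 5 ∧ s₁.word = s.word ∧
      (∀ i ≤ s.reg 0, j < i → s₁.coeff (s.reg 5 + i) = 0) ∧
      ∀ a < s.reg 5, s₁.coeff a = s.coeff a) 10 ?_ ?_ (s.reg 0) _ ?_) ?_
  · rintro s₁ ⟨-, h, -⟩
    exact h
  · rintro j s₁ ⟨h0, h1, h2, h3, h4, h5⟩
    refine ⟨by simp [Expr.eval, h1], ?_⟩
    simp only [wp_seq, wp_assign, wp_const, Expr.eval, Expr.time]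
    simp only [Function.update_apply, Fin.isValue, Fin.reduceEq, if_true, if_false, h1, h2,
      Nat.add_sub_cancel]
    refine ⟨by norm_num, by omega, trivial, trivial, h3, fun i hi hij => ?_, fun a ha => ?_⟩
    · split_ifs with hi'
      · rfl
      · exact h4 i hi (by omega)
    · rw [if_neg (by omega), h5 a ha]
  · refine ⟨le_rfl, by simp [Expr.eval], rfl, rfl, fun i h1 h2 => by omega, fun _ _ => rfl⟩
  · rintro t s₁ ⟨ht, -, -, h2, h3, h4, h5⟩
    simp only [wp_const, Expr.eval, Expr.time, h2] at ht ⊢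
    refine ⟨by omega, h3, fun i hi => ?_, fun a ha => ?_⟩
    · rcases Nat.eq_zero_or_pos i with rfl | hi'
      · simp
      · rw [Function.update_of_ne (by omega), h4 i hi hi', PowerSeries.coeff_one,
          if_neg hi'.ne']
    · rw [Function.update_of_ne (by omega), h5 a ha]

end Procedures


/-! ### Correctness and cost of the recursive procedure -/

section SeriesProcedure

variable (I : Input)

/-- The procedure `0` computes the coefficients of `quotSeries` in time `τ`. -/
def SeriesSpec (k : ℕ) (L D : List (Fin I.n)) (v : ℕ) (τ : ℝ) : Prop :=
  ∀ s : State 11, s.reg 0 = k → s.reg 3 = v → s.reg 4 ≠ 0 →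
    ListAt s.word (s.reg 4) (s.reg 1) (L.map Fin.val) →
    ListAt s.word (s.reg 4) (s.reg 2) (D.map Fin.val) →
    wp I procedures (.call 0) s fun t s' => (t : ℝ) ≤ τ ∧ s'.reg = s.reg ∧
      (∀ a < s.reg 4, s'.word a = s.word a) ∧
      (∀ i ≤ k, s'.coeff (s.reg 5 + i) = PowerSeries.coeff i (quotSeries I.adj v k D L)) ∧
      ∀ a < s.reg 5, s'.coeff a = s.coeff a

variable {I}

/-- Memory is used as a stack: a call restores the free pointers and, by the frame clauses of
`SeriesSpec`, changes no cell below them. So the lists, the series `f` and the numerator survive the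
recursive calls. -/
theorem branch_spec {k v : ℕ} {L D : List (Fin I.n)} {u : Fin I.n} {τ₁ τ₂ : ℝ}
    (h₁ : SeriesSpec I k (I.adj u ++ L) (u :: D) v τ₁)
    (h₂ : SeriesSpec I k (I.adj u) (u :: D) v τ₂) (f : PowerSeries ℚ) (s : State 11)
    (hk : s.reg 0 = k + 1) (hv : s.reg 3 = v) (hb : s.reg 4 ≠ 0) (hu : s.reg 6 = u)
    (hL : ListAt s.word (s.reg 4) (s.reg 1) (L.map Fin.val))
    (hD : ListAt s.word (s.reg 4) (s.reg 2) (D.map Fin.val))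
    (hf : ∀ i ≤ k + 1, s.coeff (s.reg 5 + i) = PowerSeries.coeff i f) :
    wp I procedures branchCmd s fun t s' =>
      (t : ℝ) ≤ τ₁ + τ₂ + 80 * ((I.adj u).length + 1) + 200 * (k + 2) ^ 2 ∧
      (∀ a < s.reg 4, s'.word a = s.word a) ∧
      (∀ i ≤ k + 1, s'.coeff (s.reg 5 + i) = PowerSeries.coeff i (f + PowerSeries.X *
        (quotSeries I.adj v k (u :: D) (I.adj u ++ L) *
          (quotSeries I.adj v k (u :: D) (I.adj u))⁻¹))) ∧
      ∀ a < s.reg 5, s'.coeff a = s.coeff a := by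
  simp only [branchCmd, wp_seq, wp_assign, wp_store, Expr.eval, Expr.time]
  simp only [Function.update_apply, Fin.isValue, Fin.reduceEq, if_true, if_false]
  refine wp_mono (push_spec I _ u (L.map Fin.val) ?_ ?_ ?_) ?_
  · simpa [Function.update_apply] using hu
  · simp
  · simp only [Function.update_apply, Fin.isValue, Fin.reduceEq, if_true, if_false]
    refine hL.congr (by omega) fun a ha => ?_
    rw [Function.update_of_ne (by omega), Function.update_of_ne (by omega)]
  simp only [Function.update_apply, Fin.isValue, Fin.reduceEq, if_true, if_false]
  rintro t₁ s₁ ⟨ht₁, hb₁, hL₁, hw₁, hc₁, hr₁⟩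
  have r0 := hr₁ 0 (by decide) (by decide) (by decide)
  have r2 := hr₁ 2 (by decide) (by decide) (by decide)
  have r3 := hr₁ 3 (by decide) (by decide) (by decide)
  have r5 := hr₁ 5 (by decide) (by decide) (by decide)
  have r6 := hr₁ 6 (by decide) (by decide) (by decide)
  have r7 := hr₁ 7 (by decide) (by decide) (by decide)
  have r8 := hr₁ 8 (by decide) (by decide) (by decide)
  simp only [Fin.isValue, Fin.reduceEq, if_true, if_false] at r0 r2 r3 r5 r6 r7 r8
  clear hr₁
  have hD₁ : ListAt s₁.word (s.reg 4 + 2) (s₁.reg 2) ((u :: D).map Fin.val) := by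
    rw [r2]
    refine hD.push hb (fun a ha => ?_) ?_ ?_
    · rw [hw₁ a (by omega), if_neg (by omega), if_neg (by omega)]
    · rw [hw₁ _ (by omega), if_neg (by omega), if_pos rfl, hu]
    · rw [hw₁ _ (by omega), if_pos rfl]
  refine wp_mono (h₁ s₁ (by omega) (by omega) (by omega) (by simpa using hL₁)
    (hD₁.congr hb₁ fun _ _ => rfl)) ?_
  rintro t₂ s₂ ⟨ht₂, hr₂, hw₂, hA, hc₂⟩
  refine wp_mono (push_spec I _ u [] ?_ ?_ ?_) ?_
  · simp [hr₂, r6, hu]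
  · simp only [Function.update_apply, Fin.isValue, Fin.reduceEq, if_false, hr₂]
    omega
  · simp [ListAt]
  simp only [Function.update_apply, Fin.isValue, Fin.reduceEq, if_false, hr₂]
  rintro t₃ s₃ ⟨ht₃, hb₃, hL₃, hw₃, hc₃, hr₃⟩
  have q0 := hr₃ 0 (by decide) (by decide) (by decide)
  have q2 := hr₃ 2 (by decide) (by decide) (by decide)
  have q3 := hr₃ 3 (by decide) (by decide) (by decide)
  have q5 := hr₃ 5 (by decide) (by decide) (by decide)
  have q7 := hr₃ 7 (by decide) (by decide) (by decide)
  have q8 := hr₃ 8 (by decide) (by decide) (by decide)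
  simp only [Fin.isValue, Fin.reduceEq, if_true, if_false] at q0 q2 q3 q5 q7 q8
  clear hr₃
  refine wp_mono (h₂ s₃ (by omega) (by omega) (by omega) (by simpa using hL₃) ?_) ?_
  · rw [q2]
    refine hD₁.congr (by omega) fun a ha => ?_
    rw [hw₃ a (by omega), hw₂ a (by omega)]
  rintro t₄ s₄ ⟨ht₄, hr₄, hw₄, hB, hc₄⟩
  refine wp_mono (div_spec I s₄ (quotSeries I.adj v k (u :: D) (I.adj u ++ L))
    (quotSeries I.adj v k (u :: D) (I.adj u)) ?_ ?_ ?_ (constantCoeff_quotSeries _ _ _ _ _)) ?_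
  · rw [hr₄]
    omega
  · intro i hi
    rw [hr₄] at hi ⊢
    rw [hc₄ _ (by omega), hc₃, q7, r7, ← r5, hA i (by omega)]
  · intro i hi
    rw [hr₄] at hi ⊢
    exact hB i (by omega)
  rintro t₅ s₅ ⟨ht₅, hr₅, hw₅, hQ, hc₅⟩
  refine wp_mono (add_spec I s₅ ?_) ?_
  · rw [hr₅, hr₄]
    omega
  rintro t₆ s₆ ⟨ht₆, hr₆, hw₆, hS, hc₆⟩
  rw [hr₄] at ht₅ hQ hc₅
  rw [hr₅, hr₄] at ht₆ hS hc₆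
  have hk₃ : s₃.reg 0 = k := by omega
  rw [hk₃] at ht₅ ht₆
  -- The block holding `f` lies below the numerator and is untouched until the final addition.
  have hcs : ∀ a < s₁.reg 5, s₅.coeff a = s.coeff a := fun a ha => by
    rw [hc₅ a (by omega), hc₄ a (by omega), hc₃, hc₂ a ha, hc₁]
  refine ⟨?_, fun a ha => ?_, fun i hi => ?_, fun a ha => ?_⟩
  · have e5 : (t₅ : ℝ) ≤ 100 * (k + 2) ^ 2 := by exact_mod_cast ht₅
    have e6 : (t₆ : ℝ) ≤ 40 * (k + 2) := by exact_mod_cast ht₆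
    have e1 : (t₁ : ℝ) ≤ 40 * ((I.adj u).length + 1) := by exact_mod_cast ht₁
    have e3 : (t₃ : ℝ) ≤ 40 * ((I.adj u).length + 1) := by exact_mod_cast ht₃
    have hk0 : (0 : ℝ) ≤ k := Nat.cast_nonneg k
    push_cast
    nlinarith
  · rw [hw₆, hw₅, hw₄ a (by omega), hw₃ a (by omega), hw₂ a (by omega), hw₁ a (by omega),
      if_neg (by omega), if_neg (by omega)]
  · rw [map_add]
    rcases i with _ | i
    · rw [PowerSeries.coeff_zero_X_mul, hc₆ _ (by omega), hcs _ (by omega),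
        hf 0 hi, add_zero]
    · have e1 : s.reg 5 + (i + 1) = s₃.reg 8 + i := by omega
      rw [PowerSeries.coeff_succ_X_mul, e1, hS i (by omega), hQ i (by omega), ← e1,
        hcs _ (by omega), hf _ hi]
  · rw [hc₆ _ (by omega), hcs _ (by omega)]

theorem seriesSpec_one {k v : ℕ} {L D : List (Fin I.n)} (h : k = 0 ∨ L = []) :
    SeriesSpec I k L D v (80 * (k + 2)) := by
  intro s hk hv hb hL hD
  refine wp_call I procedures (p := seriesProc) rfl ?_
  have hq : quotSeries I.adj v k D L = 1 := by
    rcases h with rfl | rfl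
    · rw [quotSeries]
    · cases k <;> rw [quotSeries]
  have hone : wp I procedures oneCmd s fun t s' => (t : ℝ) + 18 ≤ 80 * (k + 2) ∧
      (∀ a < s.reg 4, s'.word a = s.word a) ∧
      (∀ i ≤ k, s'.coeff (s.reg 5 + i) = PowerSeries.coeff i (quotSeries I.adj v k D L)) ∧
      ∀ a < s.reg 5, s'.coeff a = s.coeff a := by
    refine wp_mono (one_spec I s) ?_
    rintro t s' ⟨ht, hw, hc, hc'⟩
    rw [hk] at ht hc
    refine ⟨?_, fun a _ => by rw [hw], fun i hi => by rw [hq, hc i hi], hc'⟩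
    have e : (t : ℝ) ≤ 20 * (k + 2) := by exact_mod_cast ht
    have hk0 : (0 : ℝ) ≤ k := Nat.cast_nonneg k
    linarith
  rw [seriesProc, wp_ite]
  refine ⟨fun _ => ?_, fun h0 => (wp_ite _ _ _ _ _ _ _).2 ⟨fun _ => ?_, fun h1 => ?_⟩⟩
  · refine wp_mono hone ?_
    rintro t s' ⟨ht, h'⟩
    refine ⟨?_, rfl, h'⟩
    simp only [Expr.time]
    push_cast
    linarith
  · refine wp_mono hone ?_
    rintro t s' ⟨ht, h'⟩
    refine ⟨?_, rfl, h'⟩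
    simp only [Expr.time]
    push_cast
    linarith
  · simp only [Expr.eval] at h0 h1
    rcases h with h | h
    · omega
    · exact absurd (hL.eq_zero_iff.2 (by simp [h])) h1

theorem seriesSpec_cons {k v : ℕ} {L D : List (Fin I.n)} {u : Fin I.n} {τ₀ τ₁ τ₂ : ℝ}
    (h₀ : SeriesSpec I (k + 1) L D v τ₀)
    (h₁ : SeriesSpec I k (I.adj u ++ L) (u :: D) v τ₁)
    (h₂ : SeriesSpec I k (I.adj u) (u :: D) v τ₂) (hτ₁ : 0 ≤ τ₁) (hτ₂ : 0 ≤ τ₂) :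
    SeriesSpec I (k + 1) (u :: L) D v (τ₀ + τ₁ + τ₂ + 80 * ((I.adj u).length + 1) +
      200 * (k + 2) ^ 2 + 40 * (L.length + D.length) + 200) := by
  intro s hk hv hb hL hD
  refine wp_call I procedures (p := seriesProc) rfl ?_
  obtain ⟨hp, hp', hpu, hL'⟩ := hL
  rw [seriesProc, wp_ite]
  refine ⟨fun h => by simp [Expr.eval, hk] at h, fun _ => (wp_ite _ _ _ _ _ _ _).2
    ⟨fun h => absurd h hp, fun _ => ?_⟩⟩
  simp only [consCmd, wp_seq, wp_assign, Expr.eval, Expr.time]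
  refine wp_mono (h₀ _ ?_ ?_ ?_ ?_ ?_) ?_
  · simpa [Function.update_apply] using hk
  · simpa [Function.update_apply] using hv
  · simpa [Function.update_apply] using hb
  · simpa [Function.update_apply] using hL'
  · simpa [Function.update_apply] using hD
  simp only [Function.update_apply, Fin.isValue, Fin.reduceEq, if_false]
  rintro t₁ s₁ ⟨ht₁, hr₁, hw₁, hF, hc₁⟩
  have hlist : ∀ {p : ℕ} {l : List ℕ} (x : ℕ), ListAt s.word (s.reg 4) p l →
      ListAt (Function.update s₁.word (s.reg 4) x) (s.reg 4) p l := fun x h =>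
    h.congr le_rfl fun a ha => by rw [Function.update_of_ne (by omega), hw₁ a ha]
  simp only [wp_store, Expr.eval, Expr.time, hr₁]
  simp only [Function.update_apply, Fin.isValue, Fin.reduceEq, if_true, if_false, hpu, hv]
  refine wp_mono (scan_spec I _ (L.map Fin.val) ?_) ?_
  · simpa [hr₁, Function.update_apply] using hlist _ hL'
  rintro t₂ s₂ ⟨ht₂, rfl⟩
  refine wp_mono (scan_spec I _ (D.map Fin.val) ?_) ?_
  · simp only [Function.update_apply, Fin.isValue, Fin.reduceEq, if_true, if_false]
    rw [Function.update_idem]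
    exact hlist _ hD
  rintro t₃ s₃ ⟨ht₃, rfl⟩
  simp only [Function.update_apply, Fin.isValue, Fin.reduceEq, if_true, if_false,
    Function.update_idem]
  rw [List.length_map] at ht₂ ht₃
  have e₂ : (t₂ : ℝ) ≤ 40 * (L.length + 1) := by exact_mod_cast ht₂
  have e₃ : (t₃ : ℝ) ≤ 40 * (D.length + 1) := by exact_mod_cast ht₃
  -- The value of the tested cell against the case distinction in `quotSeries`.
  have hcount : v + 1 - (u : ℕ) + List.count (u : ℕ) (L.map Fin.val) +
      List.count (u : ℕ) (D.map Fin.val) = 0 ↔ ¬ ((u : ℕ) ≤ v ∨ u ∈ L ∨ u ∈ D) := by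
    simp only [Nat.add_eq_zero_iff, List.count_eq_zero, List.mem_map, ← Fin.ext_iff,
      exists_eq_right]
    rw [not_or, not_or, and_assoc]
    exact and_congr_left fun _ => by omega
  rw [wp_ite]
  refine ⟨fun h => ?_, fun h => ?_⟩
  · simp only [Expr.eval, Function.update_apply, Fin.isValue, Fin.reduceEq, if_true,
      if_false] at h
    refine wp_mono (branch_spec h₁ h₂ (quotSeries I.adj v (k + 1) D L) _ ?_ ?_ ?_ ?_ ?_ ?_ ?_) ?_
    · simpa [Function.update_apply] using hk
    · simpa [Function.update_apply] using hv
    · simpa [Function.update_apply] using hb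
    · simp
    · simpa [Function.update_apply] using hlist _ hL'
    · simpa [Function.update_apply] using hlist _ hD
    · simpa [Function.update_apply] using hF
    simp only [Function.update_apply, Fin.isValue, Fin.reduceEq, if_false]
    rintro t₄ s₄ ⟨ht₄, hw₄, hc₄, hc₄'⟩
    refine ⟨?_, trivial, fun a ha => ?_, fun i hi => ?_, fun a ha => ?_⟩
    · simp only [Expr.time]
      push_cast
      linarith
    · rw [hw₄ a ha, if_neg (by omega), hw₁ a ha]
    · rw [hc₄ i hi, quotSeries, if_neg (hcount.1 h)]
    · rw [hc₄' a ha, hc₁ a ha]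
  · simp only [Expr.eval, Function.update_apply, Fin.isValue, Fin.reduceEq, if_true,
      if_false] at h
    rw [wp_skip]
    refine ⟨?_, trivial, fun a ha => ?_, fun i hi => ?_, hc₁⟩
    · simp only [Expr.time]
      push_cast
      nlinarith [Nat.cast_nonneg (α := ℝ) (I.adj u).length, sq_nonneg ((k : ℝ) + 2)]
    · simp only
      rw [Function.update_of_ne (by omega), hw₁ a ha]
    · simp only
      rw [hF i hi, quotSeries, if_pos (not_not.1 fun h' => h (hcount.2 h')), add_zero]

/-- A bound for the running time of the procedure `0` for the order `k` and a list of length `l`. -/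
noncomputable def seriesTime (Δ m k l : ℕ) : ℝ :=
  1200 * m ^ 2 * Δ * (3 * Real.exp 1 * Δ) ^ k * (1 + 1 / Δ) ^ l

/-! ### Solving the recursion for the running time -/

section SeriesTime

variable {Δ m : ℕ} (hΔ : 1 ≤ Δ) (hm : 1 ≤ m)
include hΔ

theorem one_le_base_pow (k : ℕ) : (1 : ℝ) ≤ (3 * Real.exp 1 * Δ) ^ k := by
  have h1 : (1 : ℝ) ≤ Δ := by exact_mod_cast hΔ
  have h2 : (1 : ℝ) ≤ Real.exp 1 := Real.one_le_exp zero_le_one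
  exact one_le_pow₀ (by nlinarith)

/-- Lengthening the list by the neighbours of one vertex costs at most a factor e. -/
theorem one_add_inv_pow_le {d : ℕ} (hd : d ≤ Δ) : (1 + 1 / (Δ : ℝ)) ^ d ≤ Real.exp 1 := by
  have h1 : (1 : ℝ) ≤ Δ := by exact_mod_cast hΔ
  have h2 : 1 + 1 / (Δ : ℝ) ≤ Real.exp (1 / Δ) := by
    rw [add_comm]; exact Real.add_one_le_exp _
  calc (1 + 1 / (Δ : ℝ)) ^ d ≤ (1 + 1 / (Δ : ℝ)) ^ Δ :=
        pow_le_pow_right₀ (le_add_of_nonneg_right (by positivity)) hd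
    _ ≤ Real.exp (1 / Δ) ^ Δ := pow_le_pow_left₀ (by positivity) h2 Δ
    _ = Real.exp 1 := by
        rw [← Real.exp_nat_mul, mul_one_div_cancel (by positivity)]

/-- Bernoulli's inequality; it absorbs the overhead, linear in the list length, into the exponential
bound. -/
theorem add_le_mul_pow (l : ℕ) : (Δ : ℝ) + l ≤ Δ * (1 + 1 / (Δ : ℝ)) ^ l := by
  have h1 : (1 : ℝ) ≤ Δ := by exact_mod_cast hΔ
  have h2 : (0 : ℝ) ≤ 1 / Δ := by positivity
  have h3 := one_add_mul_le_pow (a := 1 / (Δ : ℝ)) (by linarith) l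
  calc (Δ : ℝ) + l = Δ * (1 + l * (1 / Δ)) := by field_simp
    _ ≤ _ := mul_le_mul_of_nonneg_left h3 (by linarith)

theorem le_seriesTime (k l : ℕ) : 1200 * (m : ℝ) ^ 2 * (Δ + l) ≤ seriesTime Δ m k l := by
  have h1 := one_le_base_pow hΔ k
  have h2 := add_le_mul_pow hΔ l
  calc 1200 * (m : ℝ) ^ 2 * (Δ + l)
      ≤ 1200 * (m : ℝ) ^ 2 * (Δ * (1 + 1 / (Δ : ℝ)) ^ l) := by gcongr
    _ = 1200 * (m : ℝ) ^ 2 * Δ * 1 * (1 + 1 / (Δ : ℝ)) ^ l := by ring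
    _ ≤ seriesTime Δ m k l := by rw [seriesTime]; gcongr

theorem seriesTime_nonneg (k l : ℕ) : 0 ≤ seriesTime Δ m k l :=
  (by positivity : (0 : ℝ) ≤ 1200 * (m : ℝ) ^ 2 * (Δ + l)).trans (le_seriesTime hΔ k l)

/-- With T for `seriesTime`, T(k+1, l+1) - T(k+1, l) = (1/Δ) · 3eΔ · T(k, l) = 3e T(k, l). Each of
the two recursive calls of lower order and the overhead takes at most e T(k, l), whence the 3e. -/
theorem seriesTime_step {d : ℕ} (hd : d ≤ Δ) (k l : ℕ) :
    seriesTime Δ m (k + 1) l + seriesTime Δ m k (d + l) + seriesTime Δ m k d +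
      1200 * (m : ℝ) ^ 2 * (Δ + l) ≤ seriesTime Δ m (k + 1) (l + 1) := by
  have hΔ' : (0 : ℝ) < Δ := by exact_mod_cast hΔ
  have h1 := le_seriesTime (m := m) hΔ k l
  have h2 := one_add_inv_pow_le hΔ hd
  have h3 : (1 : ℝ) ≤ (1 + 1 / (Δ : ℝ)) ^ l :=
    one_le_pow₀ (le_add_of_nonneg_right (by positivity))
  have h4 : (1 : ℝ) ≤ Real.exp 1 := Real.one_le_exp zero_le_one
  have h0 := seriesTime_nonneg (m := m) hΔ k l
  have a1 : seriesTime Δ m k (d + l) ≤ Real.exp 1 * seriesTime Δ m k l := by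
    have : seriesTime Δ m k (d + l) = (1 + 1 / (Δ : ℝ)) ^ d * seriesTime Δ m k l := by
      simp only [seriesTime, pow_add]; ring
    rw [this]
    gcongr
  have a2 : seriesTime Δ m k d ≤ Real.exp 1 * seriesTime Δ m k l := by
    simp only [seriesTime]
    calc 1200 * (m : ℝ) ^ 2 * Δ * (3 * Real.exp 1 * Δ) ^ k * (1 + 1 / (Δ : ℝ)) ^ d
        ≤ 1200 * (m : ℝ) ^ 2 * Δ * (3 * Real.exp 1 * Δ) ^ k * Real.exp 1 * 1 := by
          rw [mul_one]; gcongr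
      _ ≤ 1200 * (m : ℝ) ^ 2 * Δ * (3 * Real.exp 1 * Δ) ^ k * Real.exp 1 *
          (1 + 1 / (Δ : ℝ)) ^ l := by gcongr
      _ = _ := by ring
  have a3 : seriesTime Δ m (k + 1) (l + 1) = seriesTime Δ m (k + 1) l +
      3 * Real.exp 1 * seriesTime Δ m k l := by
    simp only [seriesTime, pow_succ]
    field_simp
  have a4 : seriesTime Δ m k l ≤ Real.exp 1 * seriesTime Δ m k l :=
    le_mul_of_one_le_left h0 h4
  rw [a3]
  linarith

include hm

theorem base_le_seriesTime {k : ℕ} (hk : k ≤ m) (l : ℕ) :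
    80 * ((k : ℝ) + 2) ≤ seriesTime Δ m k l := by
  refine le_trans ?_ (le_seriesTime hΔ k l)
  have h1 : (1 : ℝ) ≤ Δ := by exact_mod_cast hΔ
  have h2 : (1 : ℝ) ≤ m := by exact_mod_cast hm
  have h3 : (k : ℝ) ≤ m := by exact_mod_cast hk
  have h4 : (0 : ℝ) ≤ l := Nat.cast_nonneg l
  nlinarith [mul_le_mul (by nlinarith : (m : ℝ) ≤ (m : ℝ) ^ 2)
    (by linarith : (1 : ℝ) ≤ Δ + l) zero_le_one (by positivity)]

end SeriesTime

theorem SeriesSpec.mono {k v : ℕ} {L D : List (Fin I.n)} {τ τ' : ℝ} (h : SeriesSpec I k L D v τ)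
    (hτ : τ ≤ τ') : SeriesSpec I k L D v τ' := fun s h0 h1 h2 h3 h4 =>
  wp_mono (h s h0 h1 h2 h3 h4) fun _ _ h' => ⟨h'.1.trans hτ, h'.2⟩

/-- Each vertex put into `D` lowers the order by one, so `D.length + k ≤ m` persists, and scanning
`D` costs O(m). -/
theorem seriesSpec {Δ m : ℕ} (hΔ : 1 ≤ Δ) (hm : 1 ≤ m) (hdeg : ∀ u, (I.adj u).length ≤ Δ) (v : ℕ)
    (k : ℕ) (L D : List (Fin I.n)) (hk : D.length + k ≤ m) :
    SeriesSpec I k L D v (seriesTime Δ m k L.length) := by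
  induction k generalizing D L with
  | zero => exact (seriesSpec_one (Or.inl rfl)).mono (base_le_seriesTime hΔ hm (by omega) _)
  | succ k ihk =>
    induction L with
    | nil => exact (seriesSpec_one (Or.inr rfl)).mono (base_le_seriesTime hΔ hm (by omega) _)
    | cons u L ihL =>
      have hD : (u :: D).length + k ≤ m := by rw [List.length_cons]; omega
      refine (seriesSpec_cons ihL (ihk (I.adj u ++ L) (u :: D) hD) (ihk (I.adj u) (u :: D) hD)
        (seriesTime_nonneg hΔ _ _) (seriesTime_nonneg hΔ _ _)).mono ?_
      refine le_trans ?_ (seriesTime_step (m := m) hΔ (hdeg u) k L.length)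
      rw [List.length_append]
      have h1 : (1 : ℝ) ≤ Δ := by exact_mod_cast hΔ
      have h2 : (1 : ℝ) ≤ m := by exact_mod_cast hm
      have h3 : ((I.adj u).length : ℝ) ≤ Δ := by exact_mod_cast hdeg u
      have h4 : (k : ℝ) + 1 ≤ m := by exact_mod_cast (by omega : k + 1 ≤ m)
      have h5 : (D.length : ℝ) ≤ m := by exact_mod_cast (by omega : D.length ≤ m)
      have h6 : (0 : ℝ) ≤ L.length := Nat.cast_nonneg _
      have h7 : (0 : ℝ) ≤ k := Nat.cast_nonneg _
      have h8 : ((k : ℝ) + 2) ^ 2 ≤ 4 * (m : ℝ) ^ 2 := by nlinarith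
      have h9 : (m : ℝ) ≤ (m : ℝ) ^ 2 := by nlinarith
      -- With l the length of `L`, the overhead is at most 800m² + 40m + 80Δ + 40l + 280. For m = Δ
      -- = 1 and l = 0 this is 1200, the constant in `seriesTime`.
      have h10 : (Δ : ℝ) + L.length - 1 ≤ (m : ℝ) ^ 2 * (Δ + L.length - 1) :=
        le_mul_of_one_le_left (by linarith) (by linarith)
      nlinarith

end SeriesProcedure

/-! ### The main program: sum over the vertices, then division by the index -/

section MainProgram

/-- Multiplies the coefficients at the address `5` by their indices. -/
def weightCmd : Cmd 11 :=
  -- Words cannot be moved into the coefficient memory, so the index is counted there too, in one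
  -- scratch cell, with the constant 1 in the next.
  .seq (.const (.add (.add (.reg 5) (.reg 0)) (.num 1)) 0) <|
  .seq (.const (.add (.add (.reg 5) (.reg 0)) (.num 2)) 1) <|
  .seq (.assign 9 (.num 0)) <|
  .loop (.sub (.add (.reg 0) (.num 1)) (.reg 9)) <|
    .seq (.arith .mul (.add (.reg 7) (.reg 9)) (.add (.reg 5) (.reg 9))
      (.add (.add (.reg 5) (.reg 0)) (.num 1))) <|
    .seq (.arith .add (.add (.add (.reg 5) (.reg 0)) (.num 1))
      (.add (.add (.reg 5) (.reg 0)) (.num 1)) (.add (.add (.reg 5) (.reg 0)) (.num 2))) <|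
    .assign 9 (.add (.reg 9) (.num 1))

/-- Divides the coefficients `1, …, k` of the output by their indices. -/
def integrateCmd : Cmd 11 :=
  .seq (.const (.reg 7) 1) <|
  .seq (.const (.add (.reg 7) (.num 1)) 1) <|
  .seq (.assign 9 (.num 1)) <|
  .loop (.sub (.add (.reg 0) (.num 1)) (.reg 9)) <|
    .seq (.arith .div (.reg 9) (.reg 9) (.reg 7)) <|
    .seq (.arith .add (.reg 7) (.reg 7) (.add (.reg 7) (.num 1))) <|
    .assign 9 (.add (.reg 9) (.num 1))

/-- Adds the contribution of the vertex `v` to the output. -/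
def vertexCmd : Cmd 11 :=
  .seq (.assign 6 (.reg 3)) <|
  -- The word memory is reused for every vertex, from address 1 on, since 0 denotes the empty list.
  .seq (.assign 4 (.num 1)) <|
  .seq (.assign 1 (.num 0)) <|
  .seq pushCmd <|
  .seq (.call 0) <|
  .seq weightCmd <|
  .seq (.call 2) <|
  .seq (.call 3) <|
  .assign 3 (.add (.reg 3) (.num 1))

/-- The main command. -/
def mainCmd : Cmd 11 :=
  .seq (.assign 0 .inputM) <|
  -- Layout of the coefficients: output in 0, …, m, numerator in m + 1, …, 2m + 1, the stack of
  -- series from 2m + 2 on. Registers 2, 3 and 8 rely on their initial 0: empty list, first vertex,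
  -- address of the output.
  .seq (.assign 7 (.add (.reg 0) (.num 1))) <|
  .seq (.assign 5 (.add (.add (.reg 7) (.reg 0)) (.num 1))) <|
  .seq (.loop (.sub .inputN (.reg 3)) vertexCmd) <|
  integrateCmd

/-- The program that computes the Taylor polynomial of `log P`. -/
def logTaylorProgram : Program := ⟨11, procedures, mainCmd⟩

variable (I : Input)

theorem weight_spec (s : State 11) (f : PowerSeries ℚ) (h : s.reg 7 + s.reg 0 < s.reg 5)
    (hf : ∀ i ≤ s.reg 0, s.coeff (s.reg 5 + i) = PowerSeries.coeff i f) :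
    wp I procedures weightCmd s fun t s' => t ≤ 60 * (s.reg 0 + 2) ∧
      (∀ i ≤ s.reg 0, s'.coeff (s.reg 7 + i) =
        PowerSeries.coeff i (PowerSeries.X * PowerSeries.derivative ℚ f)) ∧
      (∀ i ≤ s.reg 0, s'.coeff (s.reg 5 + i) = PowerSeries.coeff i f) ∧
      (∀ a < s.reg 7, s'.coeff a = s.coeff a) ∧ ∀ r, r ≠ 9 → s'.reg r = s.reg r := by
  rw [weightCmd, wp_seq, wp_const, wp_seq, wp_const, wp_seq, wp_assign]
  simp only [Expr.eval, Expr.time]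
  refine wp_mono (wp_loop I procedures (fun j s₁ => ∃ b, b + j = s.reg 0 + 1 ∧ s₁.reg 9 = b ∧
      s₁.coeff (s.reg 5 + s.reg 0 + 1) = b ∧ s₁.coeff (s.reg 5 + s.reg 0 + 2) = 1 ∧
      (∀ i < b, s₁.coeff (s.reg 7 + i) =
        PowerSeries.coeff i (PowerSeries.X * PowerSeries.derivative ℚ f)) ∧
      (∀ i ≤ s.reg 0, s₁.coeff (s.reg 5 + i) = PowerSeries.coeff i f) ∧
      (∀ a < s.reg 7, s₁.coeff a = s.coeff a) ∧ ∀ r, r ≠ 9 → s₁.reg r = s.reg r)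
      40 ?_ ?_ (s.reg 0 + 1) _ ?_) ?_
  · rintro s₁ ⟨b, hb, h1, -, -, -, -, -, h2⟩
    simp only [Expr.eval]
    rw [h2 0 (by decide)]
    omega
  · rintro j s₁ ⟨b, hb, h1, h2, h3, h4, h5, h6, h7⟩
    have k0 := h7 0 (by decide)
    have k5 := h7 5 (by decide)
    have k7 := h7 7 (by decide)
    refine ⟨by simp only [Expr.eval]; omega, ?_⟩
    simp only [wp_seq, wp_assign, wp_arith, Expr.eval, Expr.time, ArithOp.apply, h1, k0, k5, k7]
    refine ⟨by simp, by simp, by norm_num, b + 1, by omega, by simp, ?_, ?_, fun i hi => ?_,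
      fun i hi => ?_, fun a ha => ?_, fun r hr => ?_⟩
    · rw [Function.update_self, Function.update_of_ne (by omega),
        Function.update_of_ne (by omega), h2, h3]
      push_cast
      rfl
    · rw [Function.update_of_ne (by omega), Function.update_of_ne (by omega), h3]
    · rw [Function.update_of_ne (by omega)]
      rcases Nat.lt_succ_iff_lt_or_eq.1 hi with hi | rfl
      · rw [Function.update_of_ne (by omega), h4 i hi]
      · rw [Function.update_self, h2, h5 i (by omega), coeff_X_mul_derivative, mul_comm]
    · rw [Function.update_of_ne (by omega), Function.update_of_ne (by omega), h5 i hi]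
    · rw [Function.update_of_ne (by omega), Function.update_of_ne (by omega), h6 a ha]
    · rw [Function.update_of_ne hr, h7 r hr]
  · refine ⟨0, by omega, by simp, ?_, by simp, fun i hi => by omega, fun i hi => ?_, fun a ha => ?_,
      fun r hr => Function.update_of_ne hr _ _⟩
    · dsimp only
      rw [Function.update_of_ne (by omega), Function.update_self, Nat.cast_zero]
    · dsimp only
      rw [Function.update_of_ne (by omega), Function.update_of_ne (by omega), hf i hi]
    · dsimp only
      rw [Function.update_of_ne (by omega), Function.update_of_ne (by omega)]
  · rintro t s₁ ⟨ht, b, hb, h1, h2, h3, h4, h5, h6, h7⟩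
    refine ⟨?_, fun i hi => h4 i (by omega), h5, h6, h7⟩
    simp only [Expr.time] at ht
    omega

theorem integrate_spec (s : State 11) (h : s.reg 7 = s.reg 0 + 1) :
    wp I procedures integrateCmd s fun t s' => t ≤ 60 * (s.reg 0 + 2) ∧
      s'.coeff 0 = s.coeff 0 ∧ ∀ i, 1 ≤ i → i ≤ s.reg 0 → s'.coeff i = s.coeff i / i := by
  rw [integrateCmd, wp_seq, wp_const, wp_seq, wp_const, wp_seq, wp_assign]
  simp only [Expr.eval, Expr.time]
  refine wp_mono (wp_loop I procedures (fun j s₁ => ∃ b, 1 ≤ b ∧ b + j = s.reg 0 + 1 ∧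
      s₁.reg 9 = b ∧ s₁.coeff (s.reg 0 + 1) = b ∧ s₁.coeff (s.reg 0 + 2) = 1 ∧
      s₁.coeff 0 = s.coeff 0 ∧
      (∀ i, 1 ≤ i → i < b → s₁.coeff i = s.coeff i / i) ∧
      (∀ i, b ≤ i → i ≤ s.reg 0 → s₁.coeff i = s.coeff i) ∧ ∀ r, r ≠ 9 → s₁.reg r = s.reg r)
      40 ?_ ?_ (s.reg 0) _ ?_) ?_
  · rintro s₁ ⟨b, -, hb, h1, -, -, -, -, -, h2⟩
    simp only [Expr.eval]
    rw [h2 0 (by decide)]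
    omega
  · rintro j s₁ ⟨b, hb1, hb, h1, h2, h3, h0, h4, h5, h7⟩
    have k0 := h7 0 (by decide)
    have k7 := h7 7 (by decide)
    rw [h] at k7
    have hb0 : (b : ℚ) ≠ 0 := Nat.cast_ne_zero.2 (by omega)
    refine ⟨by simp only [Expr.eval]; omega, ?_⟩
    simp only [wp_seq, wp_assign, wp_arith, Expr.eval, Expr.time, ArithOp.apply, h1, k7]
    refine ⟨fun _ => by rwa [h2], by simp, by norm_num, b + 1, by omega, by omega, by simp, ?_, ?_,
      ?_, fun i hi hib => ?_, fun i hi hik => ?_, fun r hr => ?_⟩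
    · rw [Function.update_self, Function.update_of_ne (by omega),
        Function.update_of_ne (by omega), h2, h3]
      push_cast
      rfl
    · rw [Function.update_of_ne (by omega), Function.update_of_ne (by omega), h3]
    · rw [Function.update_of_ne (by omega), Function.update_of_ne (by omega), h0]
    · rw [Function.update_of_ne (by omega)]
      rcases Nat.lt_succ_iff_lt_or_eq.1 hib with hib | rfl
      · rw [Function.update_of_ne (by omega), h4 i hi hib]
      · rw [Function.update_self, h2, h5 i le_rfl (by omega)]
    · rw [Function.update_of_ne (by omega), Function.update_of_ne (by omega),
        h5 i (by omega) hik]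
    · rw [Function.update_of_ne hr, h7 r hr]
  · rw [h]
    refine ⟨1, le_rfl, by omega, by simp, ?_, by simp, ?_, fun i hi hi' => by omega,
      fun i hi hik => ?_, fun r hr => Function.update_of_ne hr _ _⟩
    · dsimp only
      rw [Function.update_of_ne (by omega), Function.update_self, Nat.cast_one]
    · dsimp only
      rw [Function.update_of_ne (by omega), Function.update_of_ne (by omega)]
    · dsimp only
      rw [Function.update_of_ne (by omega), Function.update_of_ne (by omega)]
  · rintro t s₁ ⟨ht, b, -, hb, h1, h2, h3, h0, h4, h5, h7⟩
    refine ⟨?_, h0, fun i hi hik => h4 i hi (by omega)⟩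
    simp only [Expr.time] at ht
    omega

variable {I}

/-- The contribution of the vertex `v` to `X P' / P`. -/
noncomputable def vertexTerm (I : Input) (m v : ℕ) : PowerSeries ℚ :=
  if h : v < I.n then eulerLog (quotSeries I.adj v m [] (I.adj ⟨v, h⟩)) else 0

/-- A bound for the running time of `vertexCmd`. -/
noncomputable def vertexTime (Δ m : ℕ) : ℝ :=
  seriesTime Δ m m Δ + 40 * (Δ + 1) + 100 * (m + 2) ^ 2 + 100 * (m + 2) + 100

theorem vertex_spec {Δ : ℕ} (hΔ : 1 ≤ Δ) (hm : 1 ≤ I.m) (hdeg : ∀ u, (I.adj u).length ≤ Δ)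
    (s : State 11) (v : Fin I.n) (h0 : s.reg 0 = I.m) (h2 : s.reg 2 = 0) (h3 : s.reg 3 = v)
    (h5 : s.reg 5 = 2 * I.m + 2) (h7 : s.reg 7 = I.m + 1) (h8 : s.reg 8 = 0) :
    wp I procedures vertexCmd s fun t s' => (t : ℝ) ≤ vertexTime Δ I.m ∧
      s'.reg 0 = I.m ∧ s'.reg 2 = 0 ∧ s'.reg 3 = v + 1 ∧ s'.reg 5 = 2 * I.m + 2 ∧
      s'.reg 7 = I.m + 1 ∧ s'.reg 8 = 0 ∧ ∀ i ≤ I.m, s'.coeff i =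
        s.coeff i + PowerSeries.coeff i (vertexTerm I I.m v) := by
  simp only [vertexCmd, wp_seq, wp_assign, Expr.eval, Expr.time]
  refine wp_mono (push_spec I _ v [] ?_ ?_ ?_) ?_
  · simpa [Function.update_apply] using h3
  · simp
  · simp [ListAt]
  simp only [Function.update_apply, Fin.isValue, Fin.reduceEq, if_true, if_false]
  rintro t₁ s₁ ⟨ht₁, hb₁, hL₁, -, hc₁, hr₁⟩
  have r0 := hr₁ 0 (by decide) (by decide) (by decide)
  have r2 := hr₁ 2 (by decide) (by decide) (by decide)
  have r3 := hr₁ 3 (by decide) (by decide) (by decide)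
  have r5 := hr₁ 5 (by decide) (by decide) (by decide)
  have r7 := hr₁ 7 (by decide) (by decide) (by decide)
  have r8 := hr₁ 8 (by decide) (by decide) (by decide)
  simp only [Fin.isValue, Fin.reduceEq, if_false, h0, h2, h3, h5, h7, h8] at r0 r2 r3 r5 r7 r8
  clear hr₁
  refine wp_mono (seriesSpec hΔ hm hdeg v I.m (I.adj v) [] (by simp) s₁ r0 r3 (by omega)
    (by simpa using hL₁) (by simpa [ListAt] using r2)) ?_
  rintro t₂ s₂ ⟨ht₂, hr₂, -, hA, hc₂⟩
  refine wp_mono (weight_spec I s₂ (quotSeries I.adj v I.m [] (I.adj v)) ?_ ?_) ?_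
  · rw [hr₂]
    omega
  · rw [hr₂, r0]
    exact hA
  rintro t₃ s₃ ⟨ht₃, hN, hA₃, hc₃, hr₃⟩
  simp only [hr₂, r0, r7, r5] at ht₃ hN hA₃ hc₃ hr₃
  have q0 := hr₃ 0 (by decide)
  have q2 := hr₃ 2 (by decide)
  have q3 := hr₃ 3 (by decide)
  have q5 := hr₃ 5 (by decide)
  have q7 := hr₃ 7 (by decide)
  have q8 := hr₃ 8 (by decide)
  clear hr₃
  rw [r0] at q0
  rw [r2] at q2
  rw [r3] at q3
  rw [r5] at q5
  rw [r7] at q7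
  rw [r8] at q8
  refine wp_mono (div_spec I s₃ _ _ (by omega) (by rw [q0, q7]; exact hN)
    (by rw [q0, q5]; exact hA₃) (constantCoeff_quotSeries _ _ _ _ _)) ?_
  rintro t₄ s₄ ⟨ht₄, hr₄, -, hQ, hc₄⟩
  refine wp_mono (add_spec I s₄ (by rw [hr₄]; omega)) ?_
  rintro t₅ s₅ ⟨ht₅, hr₅, -, hS, -⟩
  simp only [hr₄, q0, q7, q8, zero_add] at ht₄ hQ hc₄ ht₅ hS
  simp only [hr₅, hr₄, q0, q2, q3, q5, q7, q8]
  refine ⟨?_, trivial, trivial, trivial, trivial, trivial, trivial, fun i hi => ?_⟩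
  · have e1 : (t₁ : ℝ) ≤ 40 * (Δ + 1) := by
      exact_mod_cast ht₁.trans (by have := hdeg v; omega)
    have e2 : (t₂ : ℝ) ≤ seriesTime Δ I.m I.m Δ := by
      refine ht₂.trans ?_
      simp only [seriesTime]
      have : (1 : ℝ) ≤ 1 + 1 / (Δ : ℝ) := le_add_of_nonneg_right (by positivity)
      gcongr
      exact hdeg v
    have e3 : (t₃ : ℝ) ≤ 60 * (I.m + 2) := by exact_mod_cast ht₃
    have e4 : (t₄ : ℝ) ≤ 100 * (I.m + 2) ^ 2 := by exact_mod_cast ht₄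
    have e5 : (t₅ : ℝ) ≤ 40 * (I.m + 2) := by exact_mod_cast ht₅
    rw [vertexTime]
    push_cast
    linarith
  · rw [hS i hi, hQ i hi, hc₄ i (by omega), hc₃ i (by omega), hc₂ i (by omega), hc₁, vertexTerm,
      dif_pos v.2, eulerLog]

theorem program_spec {Δ : ℕ} (hΔ : 1 ≤ Δ) (hm : 1 ≤ I.m) (hdeg : ∀ u, (I.adj u).length ≤ Δ) :
    wp I procedures mainCmd (State.init 11) fun t s =>
      (t : ℝ) ≤ (I.n + 1) * (vertexTime Δ I.m + 4) + 60 * (I.m + 2) + 14 ∧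
      ∀ i ≤ I.m, s.coeff i =
        PowerSeries.coeff i (∑ v : Fin I.n, eulerLog (quotSeries I.adj v I.m [] (I.adj v))) / i := by
  have hT : 0 ≤ vertexTime Δ I.m := by
    have := seriesTime_nonneg (m := I.m) hΔ I.m Δ
    rw [vertexTime]
    positivity
  have hsum : ∑ v : Fin I.n, eulerLog (quotSeries I.adj v I.m [] (I.adj v)) =
      ∑ v ∈ Finset.range I.n, vertexTerm I I.m v := by
    rw [Finset.sum_range]
    exact Finset.sum_congr rfl fun v _ => by rw [vertexTerm, dif_pos v.2]
  simp only [mainCmd, wp_seq, wp_assign, Expr.eval, Expr.time]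
  refine wp_mono (wp_loop I procedures (fun j s => ∃ b, b + j = I.n ∧ s.reg 3 = b ∧
      s.reg 0 = I.m ∧ s.reg 2 = 0 ∧ s.reg 5 = 2 * I.m + 2 ∧ s.reg 7 = I.m + 1 ∧ s.reg 8 = 0 ∧
      ∀ i ≤ I.m, s.coeff i = PowerSeries.coeff i (∑ v ∈ Finset.range b, vertexTerm I I.m v))
      -- `wp_loop` counts in natural numbers, so the real bound is rounded down.
      ⌊vertexTime Δ I.m⌋₊ ?_ ?_ I.n _ ?_) ?_
  · rintro s ⟨b, hb, h3, -⟩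
    simp only [Expr.eval]
    omega
  · rintro j s ⟨b, hb, h3, h0, h2, h5, h7, h8, hc⟩
    refine ⟨by simp only [Expr.eval]; omega, ?_⟩
    refine wp_mono (vertex_spec hΔ hm hdeg s ⟨b, by omega⟩ h0 h2 h3 h5 h7 h8) ?_
    rintro t s' ⟨ht, k0, k2, k3, k5, k7, k8, kc⟩
    refine ⟨Nat.le_floor ht, b + 1, by omega, k3, k0, k2, k5, k7, k8, fun i hi => ?_⟩
    rw [kc i hi, hc i hi, Finset.sum_range_succ, map_add]
  · refine ⟨0, by omega, ?_⟩
    simp [State.init]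
    omega
  · rintro t s ⟨ht, b, hb, h3, h0, h2, h5, h7, h8, hc⟩
    refine wp_mono (integrate_spec I s (by omega)) ?_
    rintro t' s' ⟨ht', hc0, hc'⟩
    rw [h0] at ht' hc'
    obtain rfl : b = I.n := by omega
    refine ⟨?_, fun i hi => ?_⟩
    · have e1 : (t : ℝ) ≤ (I.n + 1) * (⌊vertexTime Δ I.m⌋₊ + 4) := by
        simp only [Expr.time] at ht
        exact_mod_cast ht
      have e2 : (t' : ℝ) ≤ 60 * (I.m + 2) := by exact_mod_cast ht'
      have e3 : ((I.n : ℝ) + 1) * (⌊vertexTime Δ I.m⌋₊ + 4) ≤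
          (I.n + 1) * (vertexTime Δ I.m + 4) := by
        gcongr
        exact Nat.floor_le hT
      push_cast
      linarith
    · rw [hsum]
      rcases Nat.eq_zero_or_pos i with rfl | hi'
      -- Cell 0 is not divided by the program. It holds 0, since every summand has a factor `X`, and
      -- 0 agrees with the division by the index 0.
      · rw [hc0, hc 0 hi, map_sum]
        simp only [Nat.cast_zero, div_zero]
        refine Finset.sum_eq_zero fun v _ => ?_
        rw [vertexTerm]
        split_ifs
        · rw [eulerLog, mul_assoc, PowerSeries.coeff_zero_X_mul]
        · rw [map_zero]
      · rw [hc' i hi' hi, hc i hi]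

/-- With M = m²Δ(3eΔ)^m, each vertex takes O(M), as e ≤ 3 bounds the factor for the initial list.
This already gives O(nM); the last factor m is slack. -/
theorem total_time_le {n Δ m : ℕ} (hn : 1 ≤ n) (hΔ : 1 ≤ Δ) (hm : 1 ≤ m) :
    ((n : ℝ) + 1) * (vertexTime Δ m + 4) + 60 * (m + 2) + 14 ≤
      30000 * (n * Δ * (3 * Real.exp 1 * Δ) ^ m * m ^ 3) := by
  have h1 : (1 : ℝ) ≤ n := by exact_mod_cast hn
  have h2 : (1 : ℝ) ≤ Δ := by exact_mod_cast hΔ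
  have h3 : (1 : ℝ) ≤ m := by exact_mod_cast hm
  set B := (3 * Real.exp 1 * (Δ : ℝ)) ^ m with hB
  have hB1 : 1 ≤ B := one_le_base_pow hΔ m
  set M : ℝ := m ^ 2 * Δ * B with hM
  have hmm : (m : ℝ) ≤ (m : ℝ) ^ 2 := by nlinarith
  have hmΔ : (m : ℝ) ^ 2 ≤ (m : ℝ) ^ 2 * Δ := le_mul_of_one_le_right (by positivity) h2
  have hΔM : (Δ : ℝ) ≤ (m : ℝ) ^ 2 * Δ := le_mul_of_one_le_left (by positivity) (by linarith)
  have hMM : (m : ℝ) ^ 2 * Δ ≤ M := le_mul_of_one_le_right (by positivity) hB1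
  have hs : seriesTime Δ m m Δ ≤ 3600 * M := by
    have h4 := one_add_inv_pow_le hΔ le_rfl
    have h5 : (1 + 1 / (Δ : ℝ)) ^ Δ ≤ 3 := h4.trans (by linarith [Real.exp_one_lt_d9])
    calc seriesTime Δ m m Δ = 1200 * M * (1 + 1 / (Δ : ℝ)) ^ Δ := by
          rw [seriesTime, hM, hB]; ring
      _ ≤ 1200 * M * 3 := by gcongr
      _ = _ := by ring
  have hv : vertexTime Δ m + 4 ≤ 6000 * M := by
    rw [vertexTime]
    nlinarith
  have hM0 : 0 ≤ M := by positivity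
  calc ((n : ℝ) + 1) * (vertexTime Δ m + 4) + 60 * (m + 2) + 14
      ≤ (2 * n) * (6000 * M) + 200 * M := by
        have : ((n : ℝ) + 1) * (vertexTime Δ m + 4) ≤ (2 * n) * (6000 * M) := by
          calc ((n : ℝ) + 1) * (vertexTime Δ m + 4) ≤ (n + 1) * (6000 * M) := by gcongr
            _ ≤ _ := by gcongr; linarith
        linarith
    _ ≤ 30000 * (n * M * 1) := by nlinarith [mul_le_mul_of_nonneg_right h1 hM0]
    _ ≤ 30000 * (n * M * m) := by gcongr
    _ = _ := by rw [hM]; ring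

end MainProgram

end ChromaticTaylor

theorem mainTheorem4 :
    ∃ (A : ChromaticTaylor.Program) (c : ℝ), 0 < c ∧
      ∀ (n Δ m : ℕ), 1 ≤ n → 1 ≤ Δ → 1 ≤ m →
      ∀ (G : SimpleGraph (Fin n)) [DecidableRel G.Adj], G.maxDegree ≤ Δ →
      ∀ (adj : Fin n → List (Fin n)), ChromaticTaylor.IsAdjacencyList G adj →
        ∃ (t : ℕ) (s : ChromaticTaylor.State A.regs),
          A.HaltsIn ⟨n, m, adj⟩ t s ∧
          (t : ℝ) ≤ c * ((n : ℝ) * (Δ : ℝ) * (3 * Real.exp 1 * (Δ : ℝ)) ^ m * (m : ℝ) ^ 3) ∧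
          AnalyticAt ℂ (ChromaticTaylor.logP G) 0 ∧
          s.output m = ChromaticTaylor.taylorPolynomial (ChromaticTaylor.logP G) m := by
  refine ⟨ChromaticTaylor.logTaylorProgram, 30000, by norm_num, ?_⟩
  intro n Δ m hn hΔ hm G _ hG adj hadj
  have hdeg : ∀ u, (adj u).length ≤ Δ := fun u => by
    refine le_trans ?_ ((G.degree_le_maxDegree u).trans hG)
    rw [← List.toFinset_card_of_nodup (hadj u).1, ← G.card_neighborFinset_eq_degree]
    refine Finset.card_le_card fun w hw => ?_
    rw [SimpleGraph.mem_neighborFinset, ← (hadj u).2 w]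
    exact List.mem_toFinset.1 hw
  obtain ⟨t, s, hex, ht, hs⟩ := ChromaticTaylor.program_spec (I := ⟨n, m, adj⟩) hΔ hm hdeg
  refine ⟨t, s, hex, ht.trans (ChromaticTaylor.total_time_le hn hΔ hm),
    ChromaticTaylor.analyticAt_log_eval (ChromaticTaylor.polyP_coeff_zero G), ?_⟩
  rw [ChromaticTaylor.taylorPolynomial_logP adj hadj]
  exact Finset.sum_congr rfl fun k hk => by rw [hs k (Nat.lt_succ_iff.1 (Finset.mem_range.1 hk))]
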